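/- Let $k$ be a commutative unital ring. Let $\mathsf{gr}^{\mathsf{op}}$ be the category whose objects are the natural numbers and whose morphisms $n\to m$ are the group homomorphisms $\mathsf F_m\to \mathsf F_n$ between free groups $\mathsf F_m = \langle x_1,\dots,x_m\rangle$; it has finite products $n\times m=n+m$ (given by the free product) and the null object $0$. For $w_1,\dots,w_m\in\mathsf F_n$ write $[w_1|\cdots|w_m]_n:n\to m$ for the morphism given by $x_i\mapsto w_i$. An exponential functor is a (strong) symmetric monoidal functor $F:(\mathsf{gr}^{\mathsf{op}},+,0)\to(\mathsf{Mod}_k,\otimes,k)$; exponential functors form a category $\mathcal F^{\mathsf{exp}}(\mathsf{gr}^{\mathsf{op}};k)$ with monoidal natural transformations as morphisms. For such $F$, the module $F(1)$ is a cocommutative Hopf algebra $\mathrm{ev}_1(F)$ whose multiplication, unit, comultiplication, counit and antipode are induced, through $F(1)\otimes F(1)\cong F(2)$ and $k\cong F(0)$, by $[x_1x_2]_2:2\to1$, $0\to 1$, $[x_1|x_1]_1:1\to 2$, $1\to 0$ and $[x_1^{-1}]_1:1\to 1$. This gives a functor $\mathrm{ev}_1:\mathcal F^{\mathsf{exp}}(\mathsf{gr}^{\mathsf{op}};k)\to\mathsf{Hopf}^{\mathsf{cc}}_k$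 to the category of cocommutative Hopf algebras over $k$. For a functor $F:\mathsf{gr}^{\mathsf{op}}\to\mathsf{Mod}_k$, an object $X$ and $n\ge 0$, let $(P_nF)(X)\subseteq F(X)$ be the kernel of $e_1\circ\cdots\circ e_{n+1}\circ F(\Delta^{(n+1)}_X):F(X)\to F(X^{\times(n+1)})$, where $\Delta^{(n+1)}_X$ is the iterated diagonal, $e_m=\mathrm{id}-F(\tau_m)$, and $\tau_m$ is the endomorphism of $X^{\times(n+1)}$ that is the zero morphism on the $m$-th factor and the identity on the others. The functors $P_0F\subseteq P_1F\subseteq\cdots$ form the polynomial filtration of $F$ ($P_n$ is the right adjoint of the inclusion of the functors of degree at most $n$ in the sense of Eilenberg and Mac Lane), and $F$ is analytic if it is the colimit of this filtration. A Hopf algebra $H$ with counit $\varepsilon$ and $\overline H=\ker\varepsilon$ is conilpotent if $H=\bigcup_n P_n(H)$, where $P_n(H)=k1_H\oplus\ker\big(\overline\Delta^{(n+1)}:\overline H\to\overline H^{\otimes(n+1)}\big)$ and $\overline\Delta^{(n+1)}$ is the iterate of the reduced comultiplication $\overline\Delta(a)=\Delta(a)-a\otimes1-1\otimes a$ (with $\overline\Delta^{(1)}=\mathrm{id}$).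 Then $\mathrm{ev}_1:\mathcal F^{\mathsf{exp}}(\mathsf{gr}^{\mathsf{op}};k)\to\mathsf{Hopf}^{\mathsf{cc}}_k$ is an equivalence of categories (Pirashvili). Moreover $\mathrm{ev}_1(F)$ is conilpotent for every analytic exponential functor $F$, and the restriction of $\mathrm{ev}_1$ to the full subcategory $\mathcal F^{\mathsf{exp}}_\omega(\mathsf{gr}^{\mathsf{op}};k)$ of analytic exponential functors is an equivalence of categories $$\mathcal F^{\mathsf{exp}}_\omega(\mathsf{gr}^{\mathsf{op}};k)\;\simeq\;\mathsf{Hopf}^{\mathsf{cc,conil}}_k$$ onto the full subcategory of conilpotent cocommutative Hopf algebras. -/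

import Mathlib

open CategoryTheory MonoidalCategory CartesianMonoidalCategory Limits
open scoped TensorProduct

universe u v w x

/-! ### The category `gr^op` -/

/-- The skeleton of the opposite of the category of finitely generated free groups: an object is a
natural number `n`, standing for the free group `F_n` on `n` generators. -/
structure GrOp : Type where
  /-- The rank of the free group. -/
  rank : ℕ

namespace GrOp

/-- A morphism `n ⟶ m` in `gr^op` is a group homomorphism `F_m → F_n`. -/
instance : Category GrOp where
  Hom n m := FreeGroup (Fin m.rank) →* FreeGroup (Fin n.rank)
  id n := MonoidHom.id _
  comp f g := MonoidHom.comp f g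

/-- The morphism `[w_1 | ⋯ | w_m]_n : n ⟶ m` of `gr^op` given by `x_i ↦ w_i`. -/
def word {n m : GrOp} (w : Fin m.rank → FreeGroup (Fin n.rank)) : n ⟶ m :=
  FreeGroup.lift w

/-- A morphism of `gr^op` as a homomorphism of free groups. -/
def toHom {n m : GrOp} (f : n ⟶ m) : FreeGroup (Fin m.rank) →* FreeGroup (Fin n.rank) := f

theorem hom_ext' {n m : GrOp} {f g : n ⟶ m}
    (h : ∀ i, toHom f (FreeGroup.of i) = toHom g (FreeGroup.of i)) : f = g :=
  FreeGroup.ext_hom _ _ h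

@[simp]
theorem toHom_comp {l m n : GrOp} (f : l ⟶ m) (g : m ⟶ n) (x : FreeGroup (Fin n.rank)) :
    toHom (f ≫ g) x = toHom f (toHom g x) := rfl

@[simp]
theorem toHom_id {n : GrOp} (x : FreeGroup (Fin n.rank)) : toHom (𝟙 n) x = x := rfl

@[simp]
theorem toHom_word {n m : GrOp} (w : Fin m.rank → FreeGroup (Fin n.rank)) (i : Fin m.rank) :
    toHom (word w) (FreeGroup.of i) = w i :=
  FreeGroup.lift_apply_of

/-- The trivial homomorphisms are the zero morphisms, i.e. the morphisms factoring through the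
null object `0`. -/
instance : HasZeroMorphisms GrOp where
  zero _ _ := ⟨(1 : FreeGroup _ →* FreeGroup _)⟩
  comp_zero f _ := MonoidHom.ext fun _ => map_one (toHom f)
  zero_comp _ _ _ _ := rfl

/-- The object `0` is terminal in `gr^op`. -/
def terminalCone : LimitCone (Functor.empty.{0} GrOp) where
  cone := asEmptyCone ⟨0⟩
  isLimit := IsTerminal.ofUniqueHom (fun _ => word Fin.elim0)
    fun _ _ => hom_ext' fun i => i.elim0

/-- The object `n + m`, i.e. the free product `F_n * F_m`. -/
def sum (n m : GrOp) : GrOp := ⟨n.rank + m.rank⟩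

/-- The first projection `n + m ⟶ n`, given by the inclusion `F_n → F_n * F_m`. -/
def proj₁ (n m : GrOp) : sum n m ⟶ n :=
  word (n := sum n m) fun i => FreeGroup.of (Fin.castAdd m.rank i)

/-- The second projection `n + m ⟶ m`, given by the inclusion `F_m → F_n * F_m`. -/
def proj₂ (n m : GrOp) : sum n m ⟶ m :=
  word (n := sum n m) fun i => FreeGroup.of (Fin.natAdd n.rank i)

/-- The morphism into `n + m` with given components. -/
def pairing {l n m : GrOp} (f : l ⟶ n) (g : l ⟶ m) : l ⟶ sum n m :=
  word (m := sum n m) (Fin.append (fun i => toHom f (FreeGroup.of i))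
    (fun i => toHom g (FreeGroup.of i)))

theorem pairing_proj₁ {l n m : GrOp} (f : l ⟶ n) (g : l ⟶ m) : pairing f g ≫ proj₁ n m = f :=
  hom_ext' fun i => by
    rw [toHom_comp, proj₁, toHom_word]
    exact (toHom_word (m := sum n m) _ _).trans (Fin.append_left _ _ i)

theorem pairing_proj₂ {l n m : GrOp} (f : l ⟶ n) (g : l ⟶ m) : pairing f g ≫ proj₂ n m = g :=
  hom_ext' fun i => by
    rw [toHom_comp, proj₂, toHom_word]
    exact (toHom_word (m := sum n m) _ _).trans (Fin.append_right _ _ i)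

theorem sum_hom_ext {l n m : GrOp} {f g : l ⟶ sum n m} (h₁ : f ≫ proj₁ n m = g ≫ proj₁ n m)
    (h₂ : f ≫ proj₂ n m = g ≫ proj₂ n m) : f = g :=
  hom_ext' fun i => by
    change Fin (n.rank + m.rank) at i
    induction i using Fin.addCases with
    | left i =>
      have := congrArg (fun h => toHom h (FreeGroup.of i)) h₁
      simpa only [toHom_comp, proj₁, toHom_word] using this
    | right i =>
      have := congrArg (fun h => toHom h (FreeGroup.of i)) h₂
      simpa only [toHom_comp, proj₂, toHom_word] using this

/-- The object `n + m` is the product of `n` and `m` in `gr^op`. -/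
def productCone (n m : GrOp) : LimitCone (pair n m) where
  cone := BinaryFan.mk (proj₁ n m) (proj₂ n m)
  isLimit := BinaryFan.isLimitMk (fun s => pairing s.fst s.snd)
    (fun s => pairing_proj₁ s.fst s.snd) (fun s => pairing_proj₂ s.fst s.snd)
    (fun s _ h₁ h₂ => sum_hom_ext (h₁.trans (pairing_proj₁ s.fst s.snd).symm)
      (h₂.trans (pairing_proj₂ s.fst s.snd).symm))

/-- `gr^op` is a cartesian monoidal category, with `n ⊗ m = n + m` and unit `0`. -/
instance : CartesianMonoidalCategory GrOp := .ofChosenFiniteProducts terminalCone productCone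

instance : BraidedCategory GrOp := .ofCartesianMonoidalCategory

/-- The object `1`, i.e. the free group `F_1`. -/
def one : GrOp := ⟨1⟩

/-- The generator `x_1` of `F_1`. -/
def x : FreeGroup (Fin one.rank) := FreeGroup.of (0 : Fin 1)

/-- `∇ = [x_1 x_2]_2 : 2 ⟶ 1`. -/
def nabla : one ⊗ one ⟶ one :=
  word fun _ => FreeGroup.of (0 : Fin 2) * FreeGroup.of (1 : Fin 2)

/-- `η : 0 ⟶ 1`. -/
def unit : 𝟙_ GrOp ⟶ one := word fun _ => 1

/-- `γ = [x_1⁻¹]_1 : 1 ⟶ 1`. -/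
def gamma : one ⟶ one := word fun _ => (FreeGroup.of (0 : Fin 1))⁻¹

/-- `Δ = [x_1 | x_1]_1 : 1 ⟶ 2`. -/
def delta : one ⟶ one ⊗ one := word fun _ => FreeGroup.of (0 : Fin 1)

/-- `ε : 1 ⟶ 0`. -/
def counit : one ⟶ 𝟙_ GrOp := word Fin.elim0

theorem hom_ext_one {n : GrOp} {f g : n ⟶ one} (h : toHom f x = toHom g x) : f = g :=
  hom_ext' fun i => by
    obtain rfl : i = (0 : Fin 1) := Subsingleton.elim (α := Fin 1) _ _
    exact h

theorem nabla_x : toHom nabla x = toHom (fst one one) x * toHom (snd one one) x := rfl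

theorem comp_nabla_x {n : GrOp} (f : n ⟶ one ⊗ one) :
    toHom (f ≫ nabla) x = toHom (f ≫ fst _ _) x * toHom (f ≫ snd _ _) x := by
  rw [toHom_comp, nabla_x, map_mul]; rfl

theorem comp_unit_x {n : GrOp} (f : n ⟶ 𝟙_ GrOp) : toHom (f ≫ unit) x = 1 := by
  rw [toHom_comp]
  exact (congrArg (toHom f) (toHom_word (n := 𝟙_ GrOp) (m := one) _ (0 : Fin 1))).trans (map_one _)

theorem comp_gamma_x {n : GrOp} (f : n ⟶ one) : toHom (f ≫ gamma) x = (toHom f x)⁻¹ := by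
  rw [toHom_comp]
  exact (congrArg (toHom f) (toHom_word (n := one) (m := one) _ (0 : Fin 1))).trans (map_inv _ _)

theorem delta_eq : delta = lift (𝟙 one) (𝟙 one) := by
  apply CartesianMonoidalCategory.hom_ext
  · rw [lift_fst]; exact hom_ext_one rfl
  · rw [lift_snd]; exact hom_ext_one rfl

theorem counit_eq : counit = toUnit one := toUnit_unique _ _

/-- The Hopf monoid structure of the object `1` of `gr^op`. -/
instance : HopfObj one where
  one := unit
  mul := nabla
  comul := delta
  counit := counit
  antipode := gamma
  one_mul := hom_ext_one <| by
    rw [comp_nabla_x, whiskerRight_fst, comp_unit_x, whiskerRight_snd, _root_.one_mul,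
      leftUnitor_hom]
  mul_one := hom_ext_one <| by
    rw [comp_nabla_x, whiskerLeft_snd, comp_unit_x, whiskerLeft_fst, _root_.mul_one,
      rightUnitor_hom]
  mul_assoc := hom_ext_one <| by
    rw [comp_nabla_x, whiskerRight_fst, whiskerRight_snd, comp_nabla_x, ← Category.assoc,
      comp_nabla_x, Category.assoc, Category.assoc, whiskerLeft_fst, whiskerLeft_snd,
      associator_hom_fst, ← Category.assoc, comp_nabla_x, Category.assoc, Category.assoc,
      associator_hom_snd_fst, associator_hom_snd_snd, _root_.mul_assoc]
  counit_comul := by rw [delta_eq, counit_eq]; ext; all_goals simp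
  comul_counit := by rw [delta_eq, counit_eq]; ext; all_goals simp
  comul_assoc := by rw [delta_eq]; ext <;> simp
  mul_comul := by rw [delta_eq]; ext <;> simp
  one_comul := by
    rw [delta_eq]
    ext <;> (simp [MonObj.tensorObj.one_def]; rfl)
  mul_counit := toUnit_unique _ _
  one_counit := toUnit_unique _ _
  antipode_left := hom_ext_one <| by
    rw [← Category.assoc, comp_nabla_x, comp_unit_x, delta_eq]
    simp only [lift_whiskerRight, lift_fst, lift_snd, comp_gamma_x]
    simp
  antipode_right := hom_ext_one <| by
    rw [← Category.assoc, comp_nabla_x, comp_unit_x, delta_eq]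
    simp only [lift_whiskerLeft, lift_fst, lift_snd, comp_gamma_x]
    simp

end GrOp

/-! ### Hopf monoids and Hopf algebras -/

section Transport

open scoped MonObj ComonObj
open Functor.LaxMonoidal Functor.OplaxMonoidal Functor.Monoidal

variable {C : Type u} [Category.{v} C] [MonoidalCategory C] [BraidedCategory C]
  {D : Type w} [Category.{x} D] [MonoidalCategory D] [BraidedCategory D]

/-- A strong braided monoidal functor maps Hopf monoids to Hopf monoids: the structure morphisms of
`F X` are those of `X`, transported along the isomorphisms `F X ⊗ F X ≅ F (X ⊗ X)` and
`𝟙 ≅ F 𝟙`. -/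
abbrev hopfObjObj (F : C ⥤ D) [F.Braided] (X : C) [HopfObj X] : HopfObj (F.obj X) where
  toMonObj := Functor.monObjObj X
  toComonObj := Functor.obj.instComonObj X F
  mul_comul := by
    change (Functor.LaxMonoidal.μ F X X ≫ F.map μ[X]) ≫ F.map Δ[X] ≫ δ F X X =
      ((F.map Δ[X] ≫ δ F X X) ⊗ₘ (F.map Δ[X] ≫ δ F X X)) ≫ tensorμ _ _ _ _ ≫
        ((Functor.LaxMonoidal.μ F X X ≫ F.map μ[X]) ⊗ₘ (Functor.LaxMonoidal.μ F X X ≫ F.map μ[X]))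
    rw [← cancel_mono (Functor.LaxMonoidal.μ F X X)]
    simp only [Category.assoc, δ_μ, Category.comp_id, ← tensorHom_comp_tensorHom, μ_natural,
      tensorμ_comp_μ_tensorHom_μ_comp_μ_assoc]
    rw [tensorHom_comp_tensorHom_assoc (δ F X X), δ_μ, id_tensorHom_id, Category.id_comp,
      μ_natural_assoc]
    simp only [← F.map_comp, BimonObj.mul_comul]
  one_comul := by
    change (Functor.LaxMonoidal.ε F ≫ F.map η[X]) ≫ F.map Δ[X] ≫ δ F X X =
      (λ_ (𝟙_ D)).inv ≫ ((Functor.LaxMonoidal.ε F ≫ F.map η[X]) ⊗ₘ (Functor.LaxMonoidal.ε F ≫ F.map η[X]))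
    rw [← cancel_mono (Functor.LaxMonoidal.μ F X X)]
    simp only [Category.assoc, δ_μ, Category.comp_id, ← tensorHom_comp_tensorHom, μ_natural,
      ← F.map_comp, BimonObj.one_comul, MonObj.tensorObj.one_def]
    rw [MonoidalCategory.tensorHom_def' (Functor.LaxMonoidal.ε F), Category.assoc, ← leftUnitor_inv_naturality_assoc,
      left_unitality_inv_assoc, F.map_comp]
  mul_counit := by
    rw [Comon.tensorObj_counit]
    change (Functor.LaxMonoidal.μ F X X ≫ F.map μ[X]) ≫ F.map ε[X] ≫ Functor.OplaxMonoidal.η F =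
      ((F.map ε[X] ≫ Functor.OplaxMonoidal.η F) ⊗ₘ (F.map ε[X] ≫ Functor.OplaxMonoidal.η F)) ≫ (λ_ (𝟙_ D)).hom
    rw [← cancel_mono (Functor.LaxMonoidal.ε F)]
    simp only [Category.assoc, η_ε, Category.comp_id, ← F.map_comp, BimonObj.mul_counit,
      Comon.tensorObj_counit]
    rw [F.map_comp, ← μ_natural_assoc, ← tensorHom_comp_tensorHom, Category.assoc,
      MonoidalCategory.tensorHom_def (Functor.OplaxMonoidal.η F), Category.assoc,
      leftUnitor_naturality_assoc, η_ε, Category.comp_id, Functor.LaxMonoidal.left_unitality,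
      ← comp_whiskerRight_assoc, η_ε, id_whiskerRight, Category.id_comp]
  one_counit := by
    change (Functor.LaxMonoidal.ε F ≫ F.map η[X]) ≫ F.map ε[X] ≫ Functor.OplaxMonoidal.η F = _
    rw [Category.assoc, ← F.map_comp_assoc, BimonObj.one_counit]
    simp
  antipode := F.map (HopfObj.antipode (X := X))
  antipode_left := by
    change (F.map Δ[X] ≫ δ F X X) ≫ F.map _ ▷ _ ≫ Functor.LaxMonoidal.μ F X X ≫ F.map μ[X] =
      (F.map ε[X] ≫ Functor.OplaxMonoidal.η F) ≫ Functor.LaxMonoidal.ε F ≫ F.map η[X]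
    rw [Category.assoc, Category.assoc, η_ε_assoc, δ_natural_left_assoc, δ_μ_assoc,
      ← F.map_comp, ← F.map_comp, HopfObj.antipode_left, F.map_comp]
  antipode_right := by
    change (F.map Δ[X] ≫ δ F X X) ≫ _ ◁ F.map _ ≫ Functor.LaxMonoidal.μ F X X ≫ F.map μ[X] =
      (F.map ε[X] ≫ Functor.OplaxMonoidal.η F) ≫ Functor.LaxMonoidal.ε F ≫ F.map η[X]
    rw [Category.assoc, Category.assoc, η_ε_assoc, δ_natural_right_assoc, δ_μ_assoc,
      ← F.map_comp, ← F.map_comp, HopfObj.antipode_right, F.map_comp]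

end Transport

section ToHopfAlgebra

open scoped MonObj ComonObj
open ModuleCat.MonModuleEquivalenceAlgebra

variable {k : Type u} [CommRing k]

theorem ModuleCat.hom_congr {A B : ModuleCat.{v} k} {f g : A ⟶ B} (h : f = g) (a : A) :
    f.hom a = g.hom a := by rw [h]

/-- The coalgebra structure on a comonoid object of `Mod_k`. -/
noncomputable abbrev coalgebraOfComonObj (A : ModuleCat.{u} k) [ComonObj A] : Coalgebra k A where
  comul := (Δ[A]).hom
  counit := (ε[A]).hom
  coassoc := ModuleCat.hom_ext_iff.mp (ComonObj.comul_assoc A).symm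
  rTensor_counit_comp_comul := ModuleCat.hom_ext_iff.mp (ComonObj.counit_comul A)
  lTensor_counit_comp_comul := ModuleCat.hom_ext_iff.mp (ComonObj.comul_counit A)

theorem mul'_eq_of_monObj (A : ModuleCat.{u} k) [MonObj A] :
    LinearMap.mul' k A = (μ[A]).hom :=
  TensorProduct.ext' fun _ _ => rfl

theorem tensor_mul_of_monObj (A : ModuleCat.{u} k) [MonObj A] (s t : A ⊗[k] A) :
    (tensorμ A A A A ≫ (μ[A] ⊗ₘ μ[A])).hom (s ⊗ₜ[k] t) = s * t := by
  induction s with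
  | zero => rw [TensorProduct.zero_tmul, map_zero, zero_mul]
  | add s₁ s₂ h₁ h₂ => rw [TensorProduct.add_tmul, map_add, h₁, h₂, add_mul]
  | tmul a b =>
    induction t with
    | zero => rw [TensorProduct.tmul_zero, map_zero, mul_zero]
    | add t₁ t₂ h₁ h₂ => rw [TensorProduct.tmul_add, map_add, h₁, h₂, mul_add]
    | tmul c d => rw [Algebra.TensorProduct.tmul_mul_tmul]; rfl

/-- The Hopf algebra structure on a Hopf monoid of `Mod_k`; its multiplication is
`x * y = μ (x ⊗ y)`, its unit is `η 1`, its comultiplication, counit and antipode are `Δ`, `ε`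
and `S`. -/
noncomputable abbrev hopfAlgebraOfHopfObj (A : ModuleCat.{u} k) [HopfObj A] : HopfAlgebra k A where
  toCoalgebra := coalgebraOfComonObj A
  counit_one := ModuleCat.hom_congr (BimonObj.one_counit A) (1 : k)
  mul_compr₂_counit := by
    ext a b
    have h := ModuleCat.hom_congr (BimonObj.mul_counit A) (a ⊗ₜ[k] b)
    rw [Comon.tensorObj_counit] at h
    exact h
  comul_one := ModuleCat.hom_congr (BimonObj.one_comul A) (1 : k)
  mul_compr₂_comul := by
    ext a b
    have h := ModuleCat.hom_congr (BimonObj.mul_comul A) (a ⊗ₜ[k] b)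
    exact h.trans (tensor_mul_of_monObj A _ _)
  antipode := (HopfObj.antipode (X := A)).hom
  mul_antipode_rTensor_comul := by
    rw [mul'_eq_of_monObj]
    exact ModuleCat.hom_ext_iff.mp (HopfObj.antipode_left A)
  mul_antipode_lTensor_comul := by
    rw [mul'_eq_of_monObj]
    exact ModuleCat.hom_ext_iff.mp (HopfObj.antipode_right A)

end ToHopfAlgebra

/-! ### Exponential functors and evaluation at `F_1` -/

/-- Exponential functors `gr^op → Mod_k`, i.e. (strong) symmetric monoidal functors from
`(gr^op, +, 0)` to `(Mod_k, ⊗, k)`. -/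
structure ExpFunctor (k : Type u) [CommRing k] where
  /-- The underlying functor. -/
  toFunctor : GrOp ⥤ ModuleCat.{u} k
  /-- The symmetric monoidal structure. -/
  [braided : toFunctor.Braided]

/-- Cocommutativity of Hopf algebras. -/
def IsCocommHopf (k : Type u) [CommRing k] : ObjectProperty (HopfAlgCat.{u} k) :=
  fun H => Coalgebra.IsCocomm k H

/-- The category of cocommutative Hopf algebras over `k`. -/
abbrev CocommHopf (k : Type u) [CommRing k] : Type (u + 1) := (IsCocommHopf k).FullSubcategory

namespace ExpFunctor

variable {k : Type u} [CommRing k]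

attribute [instance] ExpFunctor.braided

/-- A morphism of exponential functors is a monoidal natural transformation. -/
@[ext]
structure Hom (F G : ExpFunctor k) where
  /-- The underlying natural transformation. -/
  natTrans : F.toFunctor ⟶ G.toFunctor
  isMonoidal : NatTrans.IsMonoidal natTrans

attribute [instance] Hom.isMonoidal

instance : Category (ExpFunctor k) where
  Hom F G := Hom F G
  id F := ⟨𝟙 F.toFunctor, inferInstance⟩
  comp f g := ⟨f.natTrans ≫ g.natTrans, inferInstance⟩

/-- The Hopf monoid `F(1)` of `Mod_k`. -/
noncomputable abbrev hopfObj (F : ExpFunctor k) : HopfObj (F.toFunctor.obj GrOp.one) :=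
  hopfObjObj F.toFunctor GrOp.one

/-- The Hopf algebra `F(1)`. -/
noncomputable def ev₁Obj (F : ExpFunctor k) : HopfAlgCat.{u} k :=
  letI := F.hopfObj
  letI := ModuleCat.MonModuleEquivalenceAlgebra.MonObj.toRing (F.toFunctor.obj GrOp.one)
  letI := hopfAlgebraOfHopfObj (F.toFunctor.obj GrOp.one)
  HopfAlgCat.of k (F.toFunctor.obj GrOp.one)

open Functor in
/-- The structure maps of `F(1)`. -/
theorem ev₁Obj_structure (F : ExpFunctor k) :
    (∀ a b : F.ev₁Obj, a * b =
      (LaxMonoidal.μ F.toFunctor GrOp.one GrOp.one ≫ F.toFunctor.map GrOp.nabla).hom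
        ((show F.toFunctor.obj GrOp.one from a) ⊗ₜ[k] (show F.toFunctor.obj GrOp.one from b))) ∧
    (∀ r : k, algebraMap k F.ev₁Obj r =
      (LaxMonoidal.ε F.toFunctor ≫ F.toFunctor.map GrOp.unit).hom r) ∧
    (Coalgebra.comul (R := k) (A := F.ev₁Obj) =
      (F.toFunctor.map GrOp.delta ≫
        OplaxMonoidal.δ F.toFunctor GrOp.one GrOp.one).hom) ∧
    (Coalgebra.counit (R := k) (A := F.ev₁Obj) =
      (F.toFunctor.map GrOp.counit ≫ OplaxMonoidal.η F.toFunctor).hom) ∧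
    (HopfAlgebra.antipode k (A := F.ev₁Obj) = (F.toFunctor.map GrOp.gamma).hom) :=
  ⟨fun _ _ => rfl, fun _ => rfl, rfl, rfl, rfl⟩

theorem ev₁Obj_isCocomm (F : ExpFunctor k) : IsCocommHopf k F.ev₁Obj where
  comm_comp_comul := by
    have h : (F.toFunctor.map GrOp.delta ≫ Functor.OplaxMonoidal.δ F.toFunctor GrOp.one GrOp.one) ≫
        (β_ _ _).hom = F.toFunctor.map GrOp.delta ≫ Functor.OplaxMonoidal.δ F.toFunctor _ _ := by
      rw [← cancel_mono (Functor.LaxMonoidal.μ F.toFunctor GrOp.one GrOp.one)]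
      have h' : GrOp.delta ≫ (β_ GrOp.one GrOp.one).hom = GrOp.delta := by
        rw [GrOp.delta_eq]; ext <;> simp
      simp only [Category.assoc, Functor.Monoidal.δ_μ, Category.comp_id,
        ← Functor.LaxBraided.braided]
      rw [Functor.Monoidal.δ_μ_assoc, ← F.toFunctor.map_comp, h']
    exact ModuleCat.hom_ext_iff.mp h

section Naturality

open Functor

variable {F G : ExpFunctor k} (f : F ⟶ G)

theorem natTrans_counit :
    (Hom.natTrans f).app GrOp.one ≫ G.toFunctor.map GrOp.counit ≫ OplaxMonoidal.η G.toFunctor =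
      F.toFunctor.map GrOp.counit ≫ OplaxMonoidal.η F.toFunctor := by
  rw [← NatTrans.naturality_assoc, ← cancel_mono (LaxMonoidal.ε G.toFunctor)]
  simp only [Category.assoc, Monoidal.η_ε, Category.comp_id]
  rw [← NatTrans.IsMonoidal.unit (τ := Hom.natTrans f), Monoidal.η_ε_assoc]

theorem natTrans_comul :
    (F.toFunctor.map GrOp.delta ≫ OplaxMonoidal.δ F.toFunctor GrOp.one GrOp.one) ≫
        ((Hom.natTrans f).app GrOp.one ⊗ₘ (Hom.natTrans f).app GrOp.one) =
      (Hom.natTrans f).app GrOp.one ≫ G.toFunctor.map GrOp.delta ≫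
        OplaxMonoidal.δ G.toFunctor GrOp.one GrOp.one := by
  rw [← NatTrans.naturality_assoc, ← cancel_mono (LaxMonoidal.μ G.toFunctor GrOp.one GrOp.one)]
  simp only [Category.assoc, Monoidal.δ_μ, Category.comp_id]
  rw [← NatTrans.IsMonoidal.tensor (τ := Hom.natTrans f), Monoidal.δ_μ_assoc]

theorem natTrans_one :
    (LaxMonoidal.ε F.toFunctor ≫ F.toFunctor.map GrOp.unit) ≫ (Hom.natTrans f).app GrOp.one =
      LaxMonoidal.ε G.toFunctor ≫ G.toFunctor.map GrOp.unit := by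
  rw [Category.assoc, NatTrans.naturality, NatTrans.IsMonoidal.unit_assoc]

theorem natTrans_mul :
    (LaxMonoidal.μ F.toFunctor GrOp.one GrOp.one ≫ F.toFunctor.map GrOp.nabla) ≫
        (Hom.natTrans f).app GrOp.one =
      ((Hom.natTrans f).app GrOp.one ⊗ₘ (Hom.natTrans f).app GrOp.one) ≫
        LaxMonoidal.μ G.toFunctor GrOp.one GrOp.one ≫ G.toFunctor.map GrOp.nabla := by
  rw [Category.assoc, NatTrans.naturality, NatTrans.IsMonoidal.tensor_assoc]

end Naturality

/-- The homomorphism `F(1) → G(1)` induced by a morphism of exponential functors. -/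
noncomputable def ev₁Map {F G : ExpFunctor k} (f : F ⟶ G) : F.ev₁Obj →ₐc[k] G.ev₁Obj where
  toLinearMap := (Hom.natTrans f).app GrOp.one |>.hom
  counit_comp := ModuleCat.hom_ext_iff.mp (natTrans_counit f)
  map_comp_comul := ModuleCat.hom_ext_iff.mp (natTrans_comul f)
  map_one' := ModuleCat.hom_congr (natTrans_one f) (1 : k)
  map_mul' a b := ModuleCat.hom_congr (natTrans_mul f)
    ((show F.toFunctor.obj GrOp.one from a) ⊗ₜ[k] (show F.toFunctor.obj GrOp.one from b))

/-- Evaluation at `F_1`, as a functor from exponential functors to cocommutative Hopf algebras. -/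
noncomputable def ev₁ (k : Type u) [CommRing k] : ExpFunctor k ⥤ CocommHopf k where
  obj F := ⟨F.ev₁Obj, F.ev₁Obj_isCocomm⟩
  map f := ObjectProperty.homMk ⟨ev₁Map f⟩

end ExpFunctor

/-! ### Polynomial filtration and analytic functors -/

namespace PolyFiltration

section Products

variable {C : Type v} [Category.{w} C] [CartesianMonoidalCategory C]

/-- The product `X_1 × ⋯ × X_n` of a finite sequence of objects. -/
def prodObj : {n : ℕ} → (Fin n → C) → C
  | 0, _ => 𝟙_ C
  | _ + 1, X => X 0 ⊗ prodObj (fun i => X i.succ)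

/-- The morphism `τ_m = id × ⋯ × p_{X_m} × ⋯ × id` of `X_1 × ⋯ × X_n`, where
`p_X : X ⟶ ∗ ⟶ X` is the zero morphism. -/
def tau [HasZeroMorphisms C] : {n : ℕ} → (X : Fin n → C) → Fin n → (prodObj X ⟶ prodObj X)
  | 0, _, m => m.elim0
  | _ + 1, X, m =>
    Fin.cases ((0 : X 0 ⟶ X 0) ▷ prodObj (fun i => X i.succ))
      (fun j => X 0 ◁ tau (fun i => X i.succ) j) m

/-- The iterated diagonal `Δ^{(n)} : X ⟶ X × ⋯ × X` (`n` factors). -/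
def diag (X : C) : (n : ℕ) → (X ⟶ prodObj (fun _ : Fin n => X))
  | 0 => toUnit X
  | n + 1 => lift (𝟙 X) (diag X n)

/-- The product `f_1 × ⋯ × f_n` of morphisms. -/
def prodMap : {n : ℕ} → {X Y : Fin n → C} → (∀ i, X i ⟶ Y i) → (prodObj X ⟶ prodObj Y)
  | 0, _, _, _ => 𝟙 (𝟙_ C)
  | _ + 1, _, _, f => f 0 ⊗ₘ prodMap (fun i => f i.succ)

theorem diag_prodMap {X Y : C} (f : X ⟶ Y) (n : ℕ) :
    diag X n ≫ prodMap (fun _ => f) = f ≫ diag Y n := by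
  induction n with
  | zero => exact toUnit_unique _ _
  | succ n ih =>
    change lift (𝟙 X) (diag X n) ≫ (f ⊗ₘ prodMap fun _ => f) = f ≫ lift (𝟙 Y) (diag Y n)
    rw [lift_map, ih, comp_lift, Category.id_comp, Category.comp_id]

/-- The projection `X_1 × ⋯ × X_n ⟶ X_i`. -/
def prodProj : {n : ℕ} → (X : Fin n → C) → (i : Fin n) → (prodObj X ⟶ X i)
  | 0, _, i => i.elim0
  | _ + 1, X, i =>
    Fin.cases (motive := fun i => prodObj X ⟶ X i) (fst (X 0) (prodObj fun i => X i.succ))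
      (fun j => snd (X 0) (prodObj fun i => X i.succ) ≫ prodProj (fun i => X i.succ) j) i

theorem diag_prodMap_prodProj {n : ℕ} (X : Fin n → C) {Z : C} (g : Z ⟶ prodObj X) :
    diag Z n ≫ prodMap (fun i => g ≫ prodProj X i) = g := by
  induction n with
  | zero => exact toUnit_unique _ _
  | succ n ih =>
    have h := ih (fun i => X i.succ) (g ≫ snd (X 0) (prodObj fun i => X i.succ))
    have h' : (fun i : Fin n => g ≫ prodProj X i.succ) = fun i : Fin n =>
        (g ≫ snd (X 0) (prodObj fun i => X i.succ)) ≫ prodProj (fun i => X i.succ) i :=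
      funext fun i => (Category.assoc g (snd (X 0) (prodObj fun i => X i.succ)) _).symm
    change lift (𝟙 Z) (diag Z n) ≫ ((g ≫ fst (X 0) (prodObj fun i => X i.succ)) ⊗ₘ
      prodMap fun i : Fin n => g ≫ prodProj X i.succ) = g
    rw [h', lift_map, h, Category.id_comp]
    exact lift_comp_fst_snd (Y := X 0) g

/-- The duplication of the first factor. -/
def dup (X : C) (n : ℕ) :
    prodObj (fun _ : Fin (n + 1) => X) ⟶ prodObj (fun _ : Fin (n + 2) => X) :=
  lift (fst X (prodObj fun _ : Fin n => X)) (𝟙 (X ⊗ prodObj fun _ : Fin n => X))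

theorem diag_dup (X : C) (n : ℕ) : diag X (n + 1) ≫ dup X n = diag X (n + 2) := by
  change lift (𝟙 X) (diag X n) ≫ lift (fst _ _) (𝟙 _) = lift (𝟙 X) (lift (𝟙 X) (diag X n))
  rw [comp_lift, lift_fst, Category.comp_id]

variable [HasZeroMorphisms C]

theorem tau_zero {n : ℕ} (X : Fin (n + 1) → C) :
    tau X 0 = (0 : X 0 ⟶ X 0) ▷ prodObj (fun i => X i.succ) := rfl

theorem tau_succ {n : ℕ} (X : Fin (n + 1) → C) (m : Fin n) :
    tau X m.succ = X 0 ◁ tau (fun i => X i.succ) m := rfl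

theorem tau_prodMap {n : ℕ} {X Y : Fin n → C} (f : ∀ i, X i ⟶ Y i) (m : Fin n) :
    tau X m ≫ prodMap f = prodMap f ≫ tau Y m := by
  induction n with
  | zero => exact m.elim0
  | succ n ih =>
    change _ ≫ (f 0 ⊗ₘ prodMap fun i => f i.succ) = (f 0 ⊗ₘ prodMap fun i => f i.succ) ≫ _
    induction m using Fin.cases with
    | zero =>
      rw [tau_zero, tau_zero]
      apply CartesianMonoidalCategory.hom_ext <;> simp
    | succ m =>
      rw [tau_succ, tau_succ]
      apply CartesianMonoidalCategory.hom_ext <;> simp [ih]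

theorem tau_tau {n : ℕ} (X : Fin n → C) (m : Fin n) : tau X m ≫ tau X m = tau X m := by
  induction n with
  | zero => exact m.elim0
  | succ n ih =>
    induction m using Fin.cases with
    | zero =>
      change (0 : X 0 ⟶ X 0) ▷ _ ≫ (0 : X 0 ⟶ X 0) ▷ _ = (0 : X 0 ⟶ X 0) ▷ _
      rw [← comp_whiskerRight, comp_zero]
    | succ m =>
      change X 0 ◁ tau (fun i => X i.succ) m ≫ X 0 ◁ tau (fun i => X i.succ) m =
        X 0 ◁ tau (fun i => X i.succ) m
      rw [← MonoidalCategory.whiskerLeft_comp, ih]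

end Products

section Filtration

variable {C : Type v} [Category.{w} C] [CartesianMonoidalCategory C] [HasZeroMorphisms C]
  {k : Type u} [CommRing k] (F : C ⥤ ModuleCat.{x} k)

/-- The idempotent `e_m = id - F(τ_m)` of `F(X_1 × ⋯ × X_n)`. -/
def idem {n : ℕ} (X : Fin n → C) (m : Fin n) : Module.End k (F.obj (prodObj X)) :=
  LinearMap.id - (F.map (tau X m)).hom

/-- The endomorphism `χ_F = e_1 ∘ ⋯ ∘ e_n` of `F(X_1 × ⋯ × X_n)`; its image is the cross-effect
`cr^n(F)(X_1, …, X_n)`. -/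
def chi {n : ℕ} (X : Fin n → C) : Module.End k (F.obj (prodObj X)) :=
  (List.ofFn (idem F X)).prod

/-- The composite `F(X) → F(X^n) → F(X^n)` of `F(Δ^{(n)})` and `χ_F`. -/
def chiDiag (n : ℕ) (X : C) : F.obj X →ₗ[k] F.obj (prodObj (fun _ : Fin n => X)) :=
  chi F (fun _ : Fin n => X) ∘ₗ (F.map (diag X n)).hom

theorem prod_comm {M N : Type*} [AddCommGroup M] [AddCommGroup N] [Module k M] [Module k N]
    (φ : M →ₗ[k] N) {n : ℕ} (e : Fin n → Module.End k M) (e' : Fin n → Module.End k N)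
    (h : ∀ i, φ ∘ₗ e i = e' i ∘ₗ φ) :
    φ ∘ₗ (List.ofFn e).prod = (List.ofFn e').prod ∘ₗ φ := by
  induction n with
  | zero => simp [Module.End.one_eq_id]
  | succ n ih =>
    rw [List.ofFn_succ, List.ofFn_succ, List.prod_cons, List.prod_cons, Module.End.mul_eq_comp,
      Module.End.mul_eq_comp, ← LinearMap.comp_assoc, h, LinearMap.comp_assoc,
      ih _ _ fun i => h i.succ, LinearMap.comp_assoc]

theorem map_idem {m n : ℕ} {X : Fin m → C} {Y : Fin n → C} (f : prodObj X ⟶ prodObj Y) (i : Fin m)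
    (j : Fin n) (h : tau X i ≫ f = f ≫ tau Y j) :
    (F.map f).hom ∘ₗ idem F X i = idem F Y j ∘ₗ (F.map f).hom := by
  rw [idem, idem, LinearMap.comp_sub, LinearMap.sub_comp, ← ModuleCat.hom_comp,
    ← ModuleCat.hom_comp, ← F.map_comp, ← F.map_comp, h]
  rfl

theorem chi_naturality {n : ℕ} {X Y : Fin n → C} (f : ∀ i, X i ⟶ Y i) :
    (F.map (prodMap f)).hom ∘ₗ chi F X = chi F Y ∘ₗ (F.map (prodMap f)).hom :=
  prod_comm _ _ _ fun i => map_idem F _ i i (tau_prodMap f i)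

theorem chiDiag_naturality (n : ℕ) {X Y : C} (f : X ⟶ Y) :
    (F.map (prodMap fun _ : Fin n => f)).hom ∘ₗ chiDiag F n X = chiDiag F n Y ∘ₗ (F.map f).hom := by
  rw [chiDiag, chiDiag, ← LinearMap.comp_assoc, chi_naturality, LinearMap.comp_assoc,
    LinearMap.comp_assoc, ← ModuleCat.hom_comp, ← ModuleCat.hom_comp, ← F.map_comp, ← F.map_comp,
    diag_prodMap]

/-- The submodule `(P_n F)(X) ⊆ F(X)`: the kernel of
`F(X) → F(X^{n+1}) → F(X^{n+1})`, the composite of `F(Δ^{(n+1)})` and `χ_F`. -/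
def polySub (n : ℕ) (X : C) : Submodule k (F.obj X) :=
  LinearMap.ker (chiDiag F (n + 1) X)

theorem map_mem_polySub (n : ℕ) {X Y : C} (f : X ⟶ Y) {a : F.obj X} (ha : a ∈ polySub F n X) :
    (F.map f).hom a ∈ polySub F n Y := by
  have h := LinearMap.congr_fun (chiDiag_naturality F (n + 1) f) a
  rw [polySub, LinearMap.mem_ker] at ha ⊢
  rw [LinearMap.comp_apply, LinearMap.comp_apply, ha, map_zero] at h
  exact h.symm

theorem tau_succ_dup (X : C) (n : ℕ) (i : Fin n) :
    tau (fun _ : Fin (n + 1) => X) i.succ ≫ dup X n =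
      dup X n ≫ tau (fun _ : Fin (n + 2) => X) i.succ.succ := by
  change (X ◁ tau (fun _ : Fin n => X) i) ≫ lift (fst _ _) (𝟙 _) =
    lift (fst _ _) (𝟙 _) ≫ X ◁ X ◁ tau (fun _ : Fin n => X) i
  simp

theorem tau_zero_dup (X : C) (n : ℕ) :
    tau (fun _ : Fin (n + 1) => X) 0 ≫ dup X n =
      (dup X n ≫ tau (fun _ : Fin (n + 2) => X) 0) ≫ tau (fun _ : Fin (n + 2) => X) 1 := by
  change (0 : X ⟶ X) ▷ (prodObj fun _ : Fin n => X) ≫ lift (fst _ _) (𝟙 _) =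
    (lift (fst _ _) (𝟙 _) ≫ (0 : X ⟶ X) ▷ (X ⊗ prodObj fun _ : Fin n => X)) ≫
      X ◁ ((0 : X ⟶ X) ▷ _)
  rw [lift_whiskerRight, lift_whiskerLeft, comp_lift]
  simp

theorem idem_comp_map_tau {n : ℕ} (X : Fin n → C) (m : Fin n) :
    idem F X m ∘ₗ (F.map (tau X m)).hom = 0 := by
  rw [idem, LinearMap.sub_comp, ← ModuleCat.hom_comp, ← F.map_comp, tau_tau, LinearMap.id_comp,
    sub_self]

theorem chi_dup (X : C) (n : ℕ) :
    chi F (fun _ : Fin (n + 2) => X) ∘ₗ (F.map (dup X n)).hom =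
      (idem F (fun _ : Fin (n + 2) => X) 0 ∘ₗ idem F (fun _ : Fin (n + 2) => X) 1) ∘ₗ
        (F.map (dup X n)).hom ∘ₗ chi F (fun _ : Fin (n + 1) => X) := by
  have h₁ : (F.map (dup X n)).hom ∘ₗ
      (List.ofFn fun i : Fin n => idem F (fun _ : Fin (n + 1) => X) i.succ).prod =
      (List.ofFn fun i : Fin n => idem F (fun _ : Fin (n + 2) => X) i.succ.succ).prod ∘ₗ
        (F.map (dup X n)).hom :=
    prod_comm _ _ _ fun i => map_idem F _ i.succ i.succ.succ (tau_succ_dup X n i)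
  have h₂ : idem F (fun _ : Fin (n + 2) => X) 1 ∘ₗ (F.map (dup X n)).hom ∘ₗ
      idem F (fun _ : Fin (n + 1) => X) 0 =
      idem F (fun _ : Fin (n + 2) => X) 1 ∘ₗ (F.map (dup X n)).hom := by
    conv_lhs => rw [idem.eq_def F (fun _ : Fin (n + 1) => X)]
    rw [LinearMap.comp_sub, LinearMap.comp_id, ← ModuleCat.hom_comp, ← F.map_comp, tau_zero_dup,
      F.map_comp _ (tau _ 1), ModuleCat.hom_comp, LinearMap.comp_sub, ← LinearMap.comp_assoc _ _ (idem _ _ _),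
      idem_comp_map_tau, LinearMap.zero_comp, sub_zero]
  rw [chi, chi, List.ofFn_succ, List.ofFn_succ, List.ofFn_succ (n := n), List.prod_cons,
    List.prod_cons, List.prod_cons]
  simp only [Module.End.mul_eq_comp, LinearMap.comp_assoc]
  rw [← h₁]
  congr 1
  rw [← LinearMap.comp_assoc _ _ (F.map (dup X n)).hom, ← LinearMap.comp_assoc _ _ (idem F _ 1), h₂]
  rfl

theorem polySub_le_succ (n : ℕ) (X : C) : polySub F n X ≤ polySub F (n + 1) X := by
  intro a ha
  rw [polySub, LinearMap.mem_ker] at ha ⊢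
  have h := LinearMap.congr_fun (chi_dup F X n) ((F.map (diag X (n + 1))).hom a)
  rw [chiDiag, ← diag_dup, F.map_comp, ModuleCat.hom_comp]
  refine h.trans ?_
  have h' : chi F (fun _ : Fin (n + 1) => X) ((F.map (diag X (n + 1))).hom a) = 0 := ha
  simp only [LinearMap.comp_apply, h', map_zero]

theorem polySub_mono (X : C) : Monotone fun n => polySub F n X :=
  monotone_nat_of_le_succ fun n => polySub_le_succ F n X

/-- The functor `P_n F`, the `n`-th term of the polynomial filtration of `F`. -/
def polyApprox (n : ℕ) : C ⥤ ModuleCat.{x} k where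
  obj X := ModuleCat.of k (polySub F n X)
  map f := ModuleCat.ofHom
    (LinearMap.restrict (F.map f).hom fun _ ha => map_mem_polySub F n f ha)
  map_id X := ModuleCat.hom_ext <| LinearMap.ext fun a =>
    Subtype.ext (ModuleCat.hom_congr (F.map_id X) a.1)
  map_comp f g := ModuleCat.hom_ext <| LinearMap.ext fun a =>
    Subtype.ext (ModuleCat.hom_congr (F.map_comp f g) a.1)

/-- The inclusion of `P_n F` in `F`. -/
def polyIncl (n : ℕ) : polyApprox F n ⟶ F where
  app X := ModuleCat.ofHom (polySub F n X).subtype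

/-- `deg F ≤ n`: the cross-effect `cr^{n+1}(F)`, i.e. the image of `χ_F`, vanishes. -/
def HasDegreeLE (n : ℕ) : Prop :=
  ∀ X : Fin (n + 1) → C, LinearMap.range (chi F X) = ⊥

theorem chi_natTrans {F G : C ⥤ ModuleCat.{x} k} (φ : F ⟶ G) {n : ℕ} (X : Fin n → C) :
    (φ.app (prodObj X)).hom ∘ₗ chi F X = chi G X ∘ₗ (φ.app (prodObj X)).hom :=
  prod_comm _ _ _ fun i => by
    rw [idem, idem, LinearMap.comp_sub, LinearMap.sub_comp, ← ModuleCat.hom_comp,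
      ← ModuleCat.hom_comp, φ.naturality]
    rfl

/-- `P_n F` has degree at most `n`. -/
theorem polyApprox_hasDegreeLE (n : ℕ) : HasDegreeLE (polyApprox F n) n := by
  intro X
  rw [LinearMap.range_eq_bot]
  refine LinearMap.ext fun a => Subtype.ext ?_
  have h₁ := LinearMap.congr_fun (chi_natTrans (polyIncl F n) X) a
  refine h₁.trans ?_
  change chi F X a.1 = 0
  have ha : chi F (fun _ : Fin (n + 1) => prodObj X)
      ((F.map (diag (prodObj X) (n + 1))).hom a.1) = 0 := a.2
  have h₂ := LinearMap.congr_fun (chi_naturality F fun i => 𝟙 _ ≫ prodProj X i)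
    ((F.map (diag (prodObj X) (n + 1))).hom a.1)
  rw [LinearMap.comp_apply, LinearMap.comp_apply, ha, map_zero, ← LinearMap.comp_apply
    (F.map (prodMap _)).hom, ← ModuleCat.hom_comp, ← F.map_comp, diag_prodMap_prodProj,
    F.map_id] at h₂
  exact h₂.symm

/-- `P_n` is right adjoint to the inclusion of the functors of degree at most `n`, with counit
`P_n F ⟶ F`: any morphism to `F` from a functor of degree at most `n` factors uniquely through
`P_n F`. -/
theorem polyIncl_universal (n : ℕ) {G : C ⥤ ModuleCat.{x} k} (hG : HasDegreeLE G n) (φ : G ⟶ F) :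
    ∃! ψ : G ⟶ polyApprox F n, ψ ≫ polyIncl F n = φ := by
  have hmem (X : C) (a : G.obj X) : (φ.app X).hom a ∈ polySub F n X := by
    have h₁ := LinearMap.congr_fun (chi_natTrans φ fun _ : Fin (n + 1) => X)
      ((G.map (diag X (n + 1))).hom a)
    rw [LinearMap.range_eq_bot.mp (hG _)] at h₁
    have h₂ := ModuleCat.hom_congr (φ.naturality (diag X (n + 1))) a
    simp only [LinearMap.comp_apply, LinearMap.zero_apply, map_zero, ModuleCat.hom_comp] at h₁ h₂
    rw [h₂] at h₁
    exact h₁.symm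
  refine ⟨{ app := fun X => ModuleCat.ofHom (LinearMap.codRestrict _ (φ.app X).hom (hmem X))
            naturality := fun X Y f => ModuleCat.hom_ext <| LinearMap.ext fun a =>
              Subtype.ext (ModuleCat.hom_congr (φ.naturality f) a) }, rfl, ?_⟩
  intro ψ hψ
  ext X a
  exact Subtype.ext (ModuleCat.hom_congr (congrArg (fun η => η.app X) hψ) a)

/-- The polynomial filtration `P_0 F ⊆ P_1 F ⊆ ⋯`. -/
def polyFiltration : ℕ ⥤ (C ⥤ ModuleCat.{x} k) where
  obj n := polyApprox F n
  map h := { app := fun X => ModuleCat.ofHom (Submodule.inclusion (polySub_mono F X (leOfHom h))) }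

/-- The inclusions `P_n F ⟶ F` form a cocone under the polynomial filtration. -/
def polyCocone : Cocone (polyFiltration F) where
  pt := F
  ι := { app := fun n => polyIncl F n }

/-- A functor is analytic if it is the colimit of its polynomial filtration. -/
def IsAnalytic : Prop := Nonempty (IsColimit (polyCocone F))

end Filtration

end PolyFiltration

/-! ### Coradical filtration and conilpotent Hopf algebras -/

namespace Coradical

section Iterate

variable {C : Type v} [Category.{w} C] [MonoidalCategory C]

/-- The tensor power `M^{⊗ (n + 1)}`. -/
def tensorPow (M : C) : ℕ → C
  | 0 => M
  | n + 1 => M ⊗ tensorPow M n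

/-- The iterate `d^{(n + 1)} : M ⟶ M^{⊗ (n + 1)}` of `d : M ⟶ M ⊗ M`; so `d^{(1)} = id` and
`d^{(2)} = d`. -/
def iterComul {M : C} (d : M ⟶ M ⊗ M) : (n : ℕ) → (M ⟶ tensorPow M n)
  | 0 => 𝟙 M
  | n + 1 => d ≫ M ◁ iterComul d n

end Iterate

variable (k : Type u) [CommRing k] (H : Type u) [Ring H] [Bialgebra k H]

/-- The augmentation ideal `H̄ = Ker ε`. -/
def augIdeal : Submodule k H := LinearMap.ker (Coalgebra.counit (R := k) (A := H))

/-- The projection `H → H̄`, `a ↦ a - ε(a) 1`. -/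
def augProj : H →ₗ[k] augIdeal k H :=
  LinearMap.codRestrict _ (LinearMap.id - Algebra.linearMap k H ∘ₗ Coalgebra.counit) fun a => by
    simp [augIdeal]

/-- The reduced comultiplication `H̄ → H̄ ⊗ H̄`. -/
noncomputable def redComul : augIdeal k H →ₗ[k] augIdeal k H ⊗[k] augIdeal k H :=
  TensorProduct.map (augProj k H) (augProj k H) ∘ₗ Coalgebra.comul ∘ₗ (augIdeal k H).subtype

/-- The reduced comultiplication is `a ↦ Δ(a) - a ⊗ 1 - 1 ⊗ a`. -/
theorem redComul_apply (a : augIdeal k H) :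
    TensorProduct.map (augIdeal k H).subtype (augIdeal k H).subtype (redComul k H a) =
      Coalgebra.comul (R := k) (a : H) - (a : H) ⊗ₜ[k] (1 : H) - (1 : H) ⊗ₜ[k] (a : H) := by
  obtain ⟨a, ha⟩ := a
  have ha' : Coalgebra.counit (R := k) a = 0 := ha
  have h : (augIdeal k H).subtype ∘ₗ augProj k H =
      LinearMap.id - Algebra.linearMap k H ∘ₗ Coalgebra.counit := rfl
  have h₁ : TensorProduct.map (Algebra.linearMap k H ∘ₗ Coalgebra.counit) LinearMap.id
      (Coalgebra.comul (R := k) a) = (1 : H) ⊗ₜ[k] a := by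
    have := congrArg (LinearMap.rTensor H (Algebra.linearMap k H))
      (Coalgebra.rTensor_counit_comul (R := k) a)
    rw [← LinearMap.rTensor_comp_apply] at this
    simpa [LinearMap.rTensor] using this
  have h₂ : TensorProduct.map LinearMap.id (Algebra.linearMap k H ∘ₗ Coalgebra.counit)
      (Coalgebra.comul (R := k) a) = a ⊗ₜ[k] (1 : H) := by
    have := congrArg (LinearMap.lTensor H (Algebra.linearMap k H))
      (Coalgebra.lTensor_counit_comul (R := k) a)
    rw [← LinearMap.lTensor_comp_apply] at this
    simpa [LinearMap.lTensor] using this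
  have h₃ : TensorProduct.map (Algebra.linearMap k H ∘ₗ Coalgebra.counit)
      (Algebra.linearMap k H ∘ₗ Coalgebra.counit) (Coalgebra.comul (R := k) a) = 0 := by
    have := congrArg (TensorProduct.map LinearMap.id
      (Algebra.linearMap k H ∘ₗ Coalgebra.counit (R := k) (A := H))) h₁
    rw [← LinearMap.comp_apply, ← TensorProduct.map_comp] at this
    simpa [ha'] using this
  change TensorProduct.map (augIdeal k H).subtype (augIdeal k H).subtype
    (TensorProduct.map (augProj k H) (augProj k H) (Coalgebra.comul (R := k) a)) = _
  have h₄ (g : H →ₗ[k] H) : TensorProduct.map (LinearMap.id - g) (LinearMap.id - g) =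
      TensorProduct.map LinearMap.id LinearMap.id - TensorProduct.map LinearMap.id g -
        TensorProduct.map g LinearMap.id + TensorProduct.map g g :=
    TensorProduct.ext' fun x y => by
      simp only [TensorProduct.map_tmul, LinearMap.sub_apply, LinearMap.add_apply,
        LinearMap.id_apply, TensorProduct.sub_tmul, TensorProduct.tmul_sub]
      abel
  rw [← LinearMap.comp_apply, ← TensorProduct.map_comp, h, h₄]
  simp only [LinearMap.add_apply, LinearMap.sub_apply, TensorProduct.map_id, LinearMap.id_apply, h₁, h₂, h₃, add_zero]

/-- The `n`-th term `P_n(H) = k 1 ⊕ Ker Δ̄^{(n+1)}` of the coradical filtration. -/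
noncomputable def coradFiltration (n : ℕ) : Submodule k H :=
  Submodule.span k {1} ⊔ Submodule.map (augIdeal k H).subtype
    (LinearMap.ker (iterComul (M := ModuleCat.of k (augIdeal k H))
      (ModuleCat.ofHom (redComul k H)) n).hom)

/-- `H` is conilpotent if it is the union of its coradical filtration. -/
def IsConilpotent : Prop := ∀ a : H, ∃ n, a ∈ coradFiltration k H n

end Coradical

/-! ### The two categories -/

/-- Analyticity of exponential functors. -/
def IsAnalyticExp (k : Type u) [CommRing k] : ObjectProperty (ExpFunctor k) :=
  fun F => PolyFiltration.IsAnalytic F.toFunctor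

/-- Conilpotency of cocommutative Hopf algebras. -/
def IsConilpotentHopf (k : Type u) [CommRing k] : ObjectProperty (CocommHopf k) :=
  fun H => Coradical.IsConilpotent k H.obj

/-- The category of analytic exponential functors `gr^op → Mod_k`, a full subcategory of the
category of exponential functors. -/
abbrev AnalyticExp (k : Type u) [CommRing k] : Type (u + 1) := (IsAnalyticExp k).FullSubcategory

/-- The category of conilpotent cocommutative Hopf algebras over `k`, a full subcategory of the
category of cocommutative Hopf algebras. -/
abbrev ConilCocommHopf (k : Type u) [CommRing k] : Type (u + 1) :=
  (IsConilpotentHopf k).FullSubcategory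

/-! ### Cocommutative comonoids form a cartesian monoidal category -/

section CocommComon

open scoped ComonObj

variable {D : Type u} [Category.{v} D] [MonoidalCategory D]

/-! The first equivalence rests on two facts. (a) Cocommutative comonoids in a symmetric monoidal
category form a cartesian category, with the tensor product as product. Each object of the cartesian
category `gr^op` is a cocommutative comonoid by its diagonal, so a symmetric monoidal `F` lifts to a
functor `ofBraided F` into cocommutative comonoids. Its product comparison map is the inverse
tensorator of `F`, so it preserves finite products. Monoidal transformations `F ⟶ G` lift to
transformations of the lifts, and transformations of the lifts are automatically monoidal.

(b) `gr^op` is the Lawvere theory of groups: a morphism `n ⟶ 1` is a word in `F_n`, so a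
product-preserving functor amounts to the group object at `1`. Faithfulness is
`natTrans_ext_app_one`, fullness `exists_natTrans_app_one`, and a group object `G` is realised by
`powerFunctor G`. Group objects in cocommutative comonoids of `Mod_k` are cocommutative Hopf
algebras.

For the restricted equivalence, analyticity means that every element of every `F(X)` lies in some
`P_n F` (`isAnalytic_iff`). At `X = 1` the two filtrations coincide (`polySub_one_eq`): under
`F(1^{n+1}) ≅ F(1)^{⊗(n+1)}` the operator `χ_F` is the tensor power of `id - ηε`, the projection
onto the augmentation ideal, and composing with `F(Δ^{(n+1)})` gives the iterated reduced
comultiplication. Hence analytic functors have conilpotent value at `1`.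

Conversely, finite degree must pass from `F(1)` to every `F(n) ≅ F(1)^{⊗n}`. This is the statement
that degrees add under `⊗` (`mem_degSub_lift`). It is proved for a degree relative to a morphism `x
: T ⟶ X`, defined by iterated differences, which for `x = 𝟙 X` gives back the polynomial filtration
with the index shifted by one. The extra parameter `T` is what lets the induction run. -/

theorem comul_tensorHom_comul_associator (A : D) [ComonObj A] :
    Δ[A] ≫ (Δ[A] ⊗ₘ Δ[A]) ≫ (α_ A A (A ⊗ A)).hom ≫ A ◁ (α_ A A A).inv =
      Δ[A] ≫ A ◁ Δ[A] ≫ A ◁ (Δ[A] ▷ A) := by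
  rw [MonoidalCategory.tensorHom_def, Category.assoc, associator_naturality_right_assoc,
    ← ComonObj.comul_assoc_assoc, ← MonoidalCategory.whiskerLeft_comp,
    ← MonoidalCategory.whiskerLeft_comp, ← MonoidalCategory.whiskerLeft_comp,
    ComonObj.comul_assoc_assoc, Iso.hom_inv_id, Category.comp_id]

/-- Coassociativity rewrites the fourfold coproduct so that the two middle factors come from a
single `Δ`. The swap of the middle factors in `tensorμ` is then absorbed by cocommutativity. -/
theorem comul_tensorHom_comul_tensorμ [BraidedCategory D] (A : D) [ComonObj A] [IsCommComonObj A] :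
    Δ[A] ≫ (Δ[A] ⊗ₘ Δ[A]) ≫ tensorμ A A A A = Δ[A] ≫ (Δ[A] ⊗ₘ Δ[A]) := by
  have h := comul_tensorHom_comul_associator A
  have h' : Δ[A] ≫ (Δ[A] ⊗ₘ Δ[A]) =
      (Δ[A] ≫ A ◁ Δ[A] ≫ A ◁ (Δ[A] ▷ A)) ≫ A ◁ (α_ A A A).hom ≫ (α_ A A (A ⊗ A)).inv := by
    rw [← h]; simp
  rw [tensorμ]
  simp only [Category.assoc] at h' ⊢
  rw [reassoc_of% h, ← MonoidalCategory.whiskerLeft_comp_assoc (f := Δ[A] ▷ A),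
    ← comp_whiskerRight, IsCommComonObj.comul_comm, h']

/-- What remains of the comultiplication of `A ⊗ B` after applying a counit in each half. This case
says that the two projections pair to the identity; the next one, with the roles exchanged, produces
the braiding. -/
theorem unitors_inv_tensorμ_unitors [BraidedCategory D] (A B : D) :
    ((ρ_ A).inv ⊗ₘ (λ_ B).inv) ≫ tensorμ A (𝟙_ D) (𝟙_ D) B ≫ ((ρ_ A).hom ⊗ₘ (λ_ B).hom) =
      𝟙 (A ⊗ B) := by
  rw [tensorμ, braiding_tensorUnit_left]
  monoidal

theorem unitors_inv_tensorμ_unitors_braiding [BraidedCategory D] (A B : D) :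
    ((λ_ A).inv ⊗ₘ (ρ_ B).inv) ≫ tensorμ (𝟙_ D) A B (𝟙_ D) ≫ ((λ_ B).hom ⊗ₘ (ρ_ A).hom) =
      (β_ A B).hom := by
  rw [tensorμ]
  monoidal

variable [SymmetricCategory D]

/-- The point at which cocommutativity makes the category cartesian: diagonals, and hence pairings
`Δ ≫ (f ⊗ g)`, are morphisms of comonoids. -/
instance (A : D) [ComonObj A] [IsCommComonObj A] : IsComonHom Δ[A] where
  hom_counit := by
    rw [Comon.tensorObj_counit, ComonObj.counit_comul_hom_assoc, Iso.inv_hom_id,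
      Category.comp_id]
  hom_comul := by rw [Comon.tensorObj_comul, comul_tensorHom_comul_tensorμ]

instance {A B A' B' : D} [ComonObj A] [ComonObj B] [ComonObj A'] [ComonObj B']
    (f : A ⟶ A') (g : B ⟶ B') [IsComonHom f] [IsComonHom g] : IsComonHom (f ⊗ₘ g) := by
  let f' : Comon.mk A ⟶ Comon.mk A' := ⟨f⟩
  let g' : Comon.mk B ⟶ Comon.mk B' := ⟨g⟩
  exact (f' ⊗ₘ g').isComonHom_hom

variable (D) in
/-- The property of comonoids to be cocommutative. -/
def isCocommComon : ObjectProperty (Comon D) := fun A => IsCommComonObj A.X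

attribute [local instance] ComonObj.instTensorUnit in
instance : (isCocommComon D).IsMonoidal where
  prop_unit := CommComon.instCommComonObjUnit
  prop_tensor A B h₁ h₂ :=
    haveI : IsCommComonObj A.X := h₁
    haveI : IsCommComonObj B.X := h₂
    inferInstanceAs (IsCommComonObj (A.X ⊗ B.X))

variable (D) in
/-- The category of cocommutative comonoids. -/
abbrev CocommComon : Type (max u v) := (isCocommComon D).FullSubcategory

namespace CocommComon

/-- The cocommutative comonoid on an object with such a structure. -/
abbrev of (A : D) [ComonObj A] [h : IsCommComonObj A] : CocommComon D := ⟨⟨A⟩, h⟩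

instance (A : CocommComon D) : IsCommComonObj A.obj.X := A.property

/-- A morphism of comonoids as a morphism of cocommutative comonoids. -/
abbrev ofHom {A B : CocommComon D} (f : A.obj.X ⟶ B.obj.X) [IsComonHom f] : A ⟶ B :=
  ObjectProperty.homMk ⟨f⟩

theorem ext {A B : CocommComon D} {f g : A ⟶ B} (h : f.hom.hom = g.hom.hom) : f = g :=
  ObjectProperty.hom_ext _ (Comon.ext h)

/-- The unit is terminal. -/
def isTerminalUnit : IsTerminal (𝟙_ (CocommComon D)) :=
  IsTerminal.ofUniqueHom (fun A => ObjectProperty.homMk (default : A.obj ⟶ Comon.trivial D))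
    fun A f => ObjectProperty.hom_ext _ ((Comon.uniqueHomToTrivial A.obj).uniq f.hom)

/-- The first projection. -/
def fst' (A B : CocommComon D) : A ⊗ B ⟶ A := A ◁ isTerminalUnit.from B ≫ (ρ_ A).hom

/-- The second projection. -/
def snd' (A B : CocommComon D) : A ⊗ B ⟶ B := isTerminalUnit.from A ▷ B ≫ (λ_ B).hom

/-- The pairing of two morphisms. -/
def lift' {T A B : CocommComon D} (f : T ⟶ A) (g : T ⟶ B) : T ⟶ A ⊗ B :=
  ObjectProperty.homMk (Y := A ⊗ B) (Comon.Hom.mk (N := A.obj ⊗ B.obj)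
    (isComonHom_hom := inferInstanceAs (IsComonHom (N := A.obj.X ⊗ B.obj.X)
      (Δ[T.obj.X] ≫ (f.hom.hom ⊗ₘ g.hom.hom)))) (Δ[T.obj.X] ≫ (f.hom.hom ⊗ₘ g.hom.hom)))

theorem fst'_hom (A B : CocommComon D) :
    (fst' A B).hom.hom = A.obj.X ◁ ε[B.obj.X] ≫ (ρ_ A.obj.X).hom := by
  change A.obj.X ◁ ε[B.obj.X] ≫ (ρ_ A.obj).hom.hom = _
  rw [Comon.monoidal_rightUnitor_hom_hom]
  change _ ≫ A.obj.X ◁ 𝟙 (𝟙_ D) ≫ _ = _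
  rw [MonoidalCategory.whiskerLeft_id, Category.id_comp]

theorem snd'_hom (A B : CocommComon D) :
    (snd' A B).hom.hom = ε[A.obj.X] ▷ B.obj.X ≫ (λ_ B.obj.X).hom := by
  change ε[A.obj.X] ▷ B.obj.X ≫ (λ_ B.obj).hom.hom = _
  rw [Comon.monoidal_leftUnitor_hom_hom]
  change _ ≫ 𝟙 (𝟙_ D) ▷ B.obj.X ≫ _ = _
  rw [MonoidalCategory.id_whiskerRight, Category.id_comp]

theorem lift'_fst' {T A B : CocommComon D} (f : T ⟶ A) (g : T ⟶ B) : lift' f g ≫ fst' A B = f := by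
  apply ext
  change (Δ[T.obj.X] ≫ (f.hom.hom ⊗ₘ g.hom.hom)) ≫ (fst' A B).hom.hom = _
  rw [fst'_hom]
  rw [Category.assoc, ← id_tensorHom, tensorHom_comp_tensorHom_assoc, IsComonHom.hom_counit,
    Category.comp_id, ComonObj.comul_counit_hom_assoc, Iso.inv_hom_id, Category.comp_id]

theorem lift'_snd' {T A B : CocommComon D} (f : T ⟶ A) (g : T ⟶ B) : lift' f g ≫ snd' A B = g := by
  apply ext
  change (Δ[T.obj.X] ≫ (f.hom.hom ⊗ₘ g.hom.hom)) ≫ (snd' A B).hom.hom = _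
  rw [snd'_hom]
  rw [Category.assoc, ← tensorHom_id, tensorHom_comp_tensorHom_assoc, IsComonHom.hom_counit,
    Category.comp_id, ComonObj.counit_comul_hom_assoc, Iso.inv_hom_id, Category.comp_id]

theorem lift'_fst'_snd' (A B : CocommComon D) : lift' (fst' A B) (snd' A B) = 𝟙 _ := by
  apply ext
  change Δ[A.obj.X ⊗ B.obj.X] ≫ ((fst' A B).hom.hom ⊗ₘ (snd' A B).hom.hom) =
    𝟙 (A.obj.X ⊗ B.obj.X)
  rw [fst'_hom, snd'_hom]
  rw [Comon.tensorObj_comul, Category.assoc, ← tensorHom_comp_tensorHom,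
    ← id_tensorHom,
    ← tensorHom_id, ← tensorμ_natural_assoc, tensorHom_comp_tensorHom_assoc, id_tensorHom,
    tensorHom_id, ComonObj.comul_counit, ComonObj.counit_comul, unitors_inv_tensorμ_unitors]

theorem comp_lift' {S T A B : CocommComon D} (h : S ⟶ T) (f : T ⟶ A) (g : T ⟶ B) :
    h ≫ lift' f g = lift' (h ≫ f) (h ≫ g) := by
  apply ext
  change h.hom.hom ≫ Δ[T.obj.X] ≫ (f.hom.hom ⊗ₘ g.hom.hom) =
    Δ[S.obj.X] ≫ ((h.hom.hom ≫ f.hom.hom) ⊗ₘ (h.hom.hom ≫ g.hom.hom))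
  rw [IsComonHom.hom_comul_assoc, tensorHom_comp_tensorHom]

/-- Cocommutative comonoids form a cartesian monoidal category. -/
instance : CartesianMonoidalCategory (CocommComon D) where
  isTerminalTensorUnit := isTerminalUnit
  fst := fst'
  snd := snd'
  fst_def _ _ := rfl
  snd_def _ _ := rfl
  tensorProductIsBinaryProduct A B := BinaryFan.isLimitMk (fun s => lift' s.fst s.snd)
    (fun s => lift'_fst' s.fst s.snd) (fun s => lift'_snd' s.fst s.snd)
    (fun s m h₁ h₂ => by
      change m ≫ fst' A B = _ at h₁
      change m ≫ snd' A B = _ at h₂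
      rw [← h₁, ← h₂, ← comp_lift', lift'_fst'_snd']
      exact (Category.comp_id m).symm)

theorem lift_hom_hom {T A B : CocommComon D} (f : T ⟶ A) (g : T ⟶ B) :
    (lift f g).hom.hom = Δ[T.obj.X] ≫ (f.hom.hom ⊗ₘ g.hom.hom) := rfl

instance : BraidedCategory (CocommComon D) := .ofCartesianMonoidalCategory

/-- The braiding on cocommutative comonoids is defined by exchanging the projections of a product.
It must be compared with that of `D` for the forgetful functor to be braided. -/
theorem braiding_hom_hom (A B : CocommComon D) :
    (β_ A B).hom.hom.hom = (β_ A.obj.X B.obj.X).hom := by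
  have h : (β_ A B).hom = lift (snd A B) (fst A B) := by ext <;> simp
  rw [h]
  change Δ[A.obj.X ⊗ B.obj.X] ≫ ((snd' A B).hom.hom ⊗ₘ (fst' A B).hom.hom) = _
  rw [fst'_hom, snd'_hom, Comon.tensorObj_comul, Category.assoc, ← tensorHom_comp_tensorHom,
    ← id_tensorHom,
    ← tensorHom_id, ← tensorμ_natural_assoc, tensorHom_comp_tensorHom_assoc, id_tensorHom,
    tensorHom_id, ComonObj.comul_counit, ComonObj.counit_comul,
    unitors_inv_tensorμ_unitors_braiding]

variable (D) in
/-- The underlying object of a cocommutative comonoid. -/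
abbrev forget : CocommComon D ⥤ D := (isCocommComon D).ι ⋙ Comon.forget D

instance : (forget D).Braided where
  braided A B := by
    rw [Functor.LaxMonoidal.comp_μ]
    change (𝟙 (A.obj.X ⊗ B.obj.X) ≫ 𝟙 (A.obj.X ⊗ B.obj.X)) ≫ (β_ A B).hom.hom.hom =
      (β_ A.obj.X B.obj.X).hom ≫ 𝟙 (B.obj.X ⊗ A.obj.X) ≫ 𝟙 (B.obj.X ⊗ A.obj.X)
    rw [Category.comp_id, Category.comp_id, Category.comp_id, braiding_hom_hom]
    exact Category.id_comp _

end CocommComon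

end CocommComon

/-! ### Product-preserving functors on `gr^op` and group objects -/

theorem preservesFiniteProducts_of_isIso_comparison {C : Type u} [Category.{v} C]
    [CartesianMonoidalCategory C] {D : Type w} [Category.{x} D] [CartesianMonoidalCategory D]
    (P : C ⥤ D) [∀ A B, IsIso (CartesianMonoidalCategory.prodComparison P A B)]
    [IsIso (CartesianMonoidalCategory.terminalComparison P)] :
    PreservesFiniteProducts P :=
  have := preservesLimitsOfShape_discrete_walkingPair_of_isIso_prodComparison P
  have := preservesLimit_empty_of_isIso_terminalComparison P
  have := Limits.preservesLimitsOfShape_pempty_of_preservesTerminal P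
  .of_preserves_binary_and_terminal _

namespace PolyFiltration

variable {C : Type v} [Category.{w} C] [CartesianMonoidalCategory C]

/-- The morphism to a product with given components. -/
def prodLift {n : ℕ} {X : Fin n → C} {Z : C} (g : ∀ i, Z ⟶ X i) : Z ⟶ prodObj X :=
  diag Z n ≫ prodMap g

@[simp]
theorem prodLift_prodProj {n : ℕ} {X : Fin n → C} {Z : C} (g : ∀ i, Z ⟶ X i) (i : Fin n) :
    prodLift g ≫ prodProj X i = g i := by
  induction n with
  | zero => exact i.elim0
  | succ n ih =>
    have h : prodLift g = lift (g 0) (prodLift fun i => g i.succ) := by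
      change lift (𝟙 Z) (diag Z n) ≫ (g 0 ⊗ₘ prodMap fun i => g i.succ) = _
      rw [lift_map, Category.id_comp, prodLift]
    rw [h]
    induction i using Fin.cases with
    | zero => exact lift_fst _ _
    | succ i => exact (lift_snd_assoc _ _ _).trans (ih _ _)

theorem prodObj_hom_ext {n : ℕ} {X : Fin n → C} {Z : C} {f g : Z ⟶ prodObj X}
    (h : ∀ i, f ≫ prodProj X i = g ≫ prodProj X i) : f = g := by
  rw [← diag_prodMap_prodProj X f, ← diag_prodMap_prodProj X g]
  simp only [h]

end PolyFiltration

namespace GrOp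

open PolyFiltration
open scoped MonObj

/-- Precomposition as a homomorphism of monoids. -/
def precompHom {C : Type v} [Category.{w} C] [CartesianMonoidalCategory C]
    {X Y : C} (h : X ⟶ Y) (G : C) [MonObj G] : (Y ⟶ G) →* (X ⟶ G) where
  toFun g := h ≫ g
  map_one' := MonObj.comp_one h
  map_mul' := MonObj.comp_mul h

/-- The generators of `F_n` in `F_n * F_m`. -/
def inl (n m : GrOp) (i : Fin n.rank) : Fin (n ⊗ m).rank := Fin.castAdd m.rank i

/-- The generators of `F_m` in `F_n * F_m`. -/
def inr (n m : GrOp) (i : Fin m.rank) : Fin (n ⊗ m).rank := Fin.natAdd n.rank i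

theorem inl_inr_cases {n m : GrOp} {p : Fin (n ⊗ m).rank → Prop} (hl : ∀ i, p (inl n m i))
    (hr : ∀ i, p (inr n m i)) (i : Fin (n ⊗ m).rank) : p i :=
  Fin.addCases (motive := p) hl hr i

theorem exists_inl_inr {T : Type*} {n m : GrOp} (f : Fin n.rank → T) (g : Fin m.rank → T) :
    ∃ h : Fin (n ⊗ m).rank → T, (∀ i, h (inl n m i) = f i) ∧ ∀ i, h (inr n m i) = g i :=
  ⟨Fin.append f g, Fin.append_left f g, Fin.append_right f g⟩

theorem toHom_fst_of (n m : GrOp) (i : Fin n.rank) :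
    toHom (fst n m) (FreeGroup.of i) = FreeGroup.of (inl n m i) :=
  toHom_word (n := sum n m) (m := n) _ i

theorem toHom_snd_of (n m : GrOp) (i : Fin m.rank) :
    toHom (snd n m) (FreeGroup.of i) = FreeGroup.of (inr n m i) :=
  toHom_word (n := sum n m) (m := m) _ i

/-- Induction on the rank; `n ⊗ one` is definitionally the object of the next rank. -/
theorem induction_tensor {p : GrOp → Prop} (zero : p (𝟙_ GrOp)) (succ : ∀ n, p n → p (n ⊗ one))
    (n : GrOp) : p n := by
  obtain ⟨n⟩ := n
  induction n with
  | zero => exact zero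
  | succ n ih => exact succ _ ih

/-! ### The powers of a group object as a functor on `gr^op`. -/

section PowerFunctor

variable {C : Type v} [Category.{w} C] [CartesianMonoidalCategory C] (G : C) [GrpObj G]

/-- The evaluation of words in the group of morphisms `G^n ⟶ G`. -/
def evalWord (n : ℕ) : FreeGroup (Fin n) →* (prodObj (fun _ : Fin n => G) ⟶ G) :=
  FreeGroup.lift fun i => prodProj (fun _ : Fin n => G) i

theorem evalWord_of (n : ℕ) (i : Fin n) :
    evalWord G n (FreeGroup.of i) = prodProj (fun _ : Fin n => G) i :=
  FreeGroup.lift_apply_of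

/-- Substitution of words, from which functoriality of `powerFunctor` follows. Both sides are
homomorphisms in `w` out of a free group, because precomposition respects the group structure on
morphisms into `G`, so generators suffice. -/
theorem prodLift_evalWord {n m : GrOp} (f : n ⟶ m) (w : FreeGroup (Fin m.rank)) :
    prodLift (fun i => evalWord G n.rank (toHom f (FreeGroup.of i))) ≫ evalWord G m.rank w =
      evalWord G n.rank (toHom f w) := by
  have h : (precompHom (prodLift fun i => evalWord G n.rank (toHom f (FreeGroup.of i))) G).comp
      (evalWord G m.rank) = (evalWord G n.rank).comp (toHom f) :=
    FreeGroup.ext_hom _ _ fun i => by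
      change _ ≫ evalWord G m.rank (FreeGroup.of i) = _
      rw [evalWord_of]
      exact prodLift_prodProj _ i
  exact DFunLike.congr_fun h w

/-- The functor `n ↦ G^n` defined by a group object `G`; a morphism `[w_1 | ⋯ | w_m]_n` acts by
evaluation of the words `w_1, …, w_m`. -/
def powerFunctor : GrOp ⥤ C where
  obj n := prodObj (fun _ : Fin n.rank => G)
  map {n m} f := prodLift (X := fun _ : Fin m.rank => G) fun i =>
    evalWord G n.rank (toHom f (FreeGroup.of i))
  map_id n := prodObj_hom_ext fun i => by
    rw [prodLift_prodProj, toHom_id, evalWord_of, Category.id_comp]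
  map_comp f g := prodObj_hom_ext fun i => by
    rw [prodLift_prodProj, Category.assoc, prodLift_prodProj, prodLift_evalWord, toHom_comp]

/-- The projections `G^n ⟶ G`. -/
def powerProj (n : GrOp) (i : Fin n.rank) : (powerFunctor G).obj n ⟶ G :=
  prodProj (fun _ : Fin n.rank => G) i

variable {G} in
/-- The morphism to `G^n` with given components. -/
def powerLift {n : GrOp} {Z : C} (g : Fin n.rank → (Z ⟶ G)) : Z ⟶ (powerFunctor G).obj n :=
  prodLift g

@[simp]
theorem powerLift_powerProj {n : GrOp} {Z : C} (g : Fin n.rank → (Z ⟶ G)) (i : Fin n.rank) :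
    powerLift g ≫ powerProj G n i = g i :=
  prodLift_prodProj _ i

variable {G} in
theorem power_hom_ext {n : GrOp} {Z : C} {f g : Z ⟶ (powerFunctor G).obj n}
    (h : ∀ i, f ≫ powerProj G n i = g ≫ powerProj G n i) : f = g :=
  prodObj_hom_ext h

/-- The evaluation of words in the group of morphisms `G^n ⟶ G`. -/
def powerEval (n : GrOp) : FreeGroup (Fin n.rank) →* ((powerFunctor G).obj n ⟶ G) :=
  evalWord G n.rank

theorem powerEval_of (n : GrOp) (i : Fin n.rank) :
    powerEval G n (FreeGroup.of i) = powerProj G n i := evalWord_of G _ i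

theorem map_powerProj {n m : GrOp} (f : n ⟶ m) (i : Fin m.rank) :
    (powerFunctor G).map f ≫ powerProj G m i = powerEval G n (toHom f (FreeGroup.of i)) :=
  prodLift_prodProj _ i

theorem map_fst_powerProj (n m : GrOp) (i : Fin n.rank) :
    (powerFunctor G).map (fst n m) ≫ powerProj G n i = powerProj G (n ⊗ m) (inl n m i) := by
  rw [map_powerProj, toHom_fst_of, powerEval_of]

theorem map_snd_powerProj (n m : GrOp) (i : Fin m.rank) :
    (powerFunctor G).map (snd n m) ≫ powerProj G m i = powerProj G (n ⊗ m) (inr n m i) := by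
  rw [map_powerProj, toHom_snd_of, powerEval_of]

instance (n m : GrOp) : IsIso (CartesianMonoidalCategory.prodComparison (powerFunctor G) n m) := by
  obtain ⟨h, hl, hr⟩ := exists_inl_inr
    (fun i => fst ((powerFunctor G).obj n) ((powerFunctor G).obj m) ≫ powerProj G n i)
    (fun i => snd ((powerFunctor G).obj n) ((powerFunctor G).obj m) ≫ powerProj G m i)
  refine ⟨powerLift h, power_hom_ext ?_, ?_⟩
  · refine inl_inr_cases (fun i => ?_) fun i => ?_
    · rw [Category.assoc, powerLift_powerProj, hl,
        CartesianMonoidalCategory.prodComparison_fst_assoc, map_fst_powerProj, Category.id_comp]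
    · rw [Category.assoc, powerLift_powerProj, hr,
        CartesianMonoidalCategory.prodComparison_snd_assoc, map_snd_powerProj, Category.id_comp]
  · apply CartesianMonoidalCategory.hom_ext
    · rw [Category.assoc, CartesianMonoidalCategory.prodComparison_fst, Category.id_comp]
      exact power_hom_ext fun i => by
        rw [Category.assoc, map_fst_powerProj, powerLift_powerProj, hl]
    · rw [Category.assoc, CartesianMonoidalCategory.prodComparison_snd, Category.id_comp]
      exact power_hom_ext fun i => by
        rw [Category.assoc, map_snd_powerProj, powerLift_powerProj, hr]

instance : IsIso (CartesianMonoidalCategory.terminalComparison (powerFunctor G)) :=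
  ⟨powerLift fun i : Fin 0 => i.elim0, power_hom_ext fun i : Fin 0 => i.elim0, toUnit_unique _ _⟩

instance : PreservesFiniteProducts (powerFunctor G) :=
  preservesFiniteProducts_of_isIso_comparison _

/-- The index of the generator of `F_1`. -/
def idx : Fin one.rank := (0 : Fin 1)

theorem eq_idx (i : Fin one.rank) : i = idx := Subsingleton.elim (α := Fin 1) _ _

/-- The first power of `G` is `G`. -/
def powerOneIso : (powerFunctor G).obj one ≅ G where
  hom := powerProj G one idx
  inv := powerLift fun _ => 𝟙 G
  hom_inv_id := power_hom_ext fun i => by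
    rw [eq_idx i, Category.assoc, powerLift_powerProj, Category.comp_id, Category.id_comp]
  inv_hom_id := powerLift_powerProj G _ _

/-- Evaluating the word `x_1 x_2` multiplies the two coordinates, so the multiplication induced on
the first power is that of `G`. -/
theorem map_nabla_powerOneIso :
    (powerFunctor G).map nabla ≫ (powerOneIso G).hom =
      lift ((powerFunctor G).map (fst _ _) ≫ (powerOneIso G).hom)
        ((powerFunctor G).map (snd _ _) ≫ (powerOneIso G).hom) ≫ μ[G] := by
  change _ ≫ powerProj G one idx = (_ ≫ powerProj G one idx) * (_ ≫ powerProj G one idx)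
  rw [map_powerProj, map_powerProj, map_powerProj, ← map_mul]
  exact congrArg _ nabla_x

theorem map_unit_powerOneIso :
    (powerFunctor G).map unit ≫ (powerOneIso G).hom = toUnit _ ≫ η[G] := by
  change _ ≫ powerProj G one idx = 1
  rw [map_powerProj, ← map_one (powerEval G (𝟙_ GrOp))]
  exact congrArg _ (toHom_word (n := 𝟙_ GrOp) (m := one) _ (0 : Fin 1))

end PowerFunctor

/-! ### Product-preserving functors on `gr^op` are determined by their value at `1`. -/

section Extension

variable {C : Type v} [Category.{w} C] [CartesianMonoidalCategory C]

/-- The `i`-th projection `n ⟶ 1`. -/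
def coord (n : GrOp) (i : Fin n.rank) : n ⟶ one := word fun _ => FreeGroup.of i

theorem word_coord {n : GrOp} (w : FreeGroup (Fin n.rank)) :
    toHom (word (m := one) fun _ => w) x = w := toHom_word (m := one) _ (0 : Fin 1)

/-- Elements of `F_n` as morphisms `n ⟶ 1`. -/
def wordHom (n : GrOp) : FreeGroup (Fin n.rank) →* (n ⟶ one) where
  toFun w := word fun _ => w
  map_one' := hom_ext_one <| by
    rw [word_coord, Hom.one_def]; exact (comp_unit_x _).symm
  map_mul' a b := hom_ext_one <| by
    rw [word_coord, Hom.mul_def]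
    refine Eq.trans ?_ (comp_nabla_x _).symm
    rw [lift_fst, lift_snd, word_coord, word_coord]

theorem wordHom_toHom_x {n : GrOp} (f : n ⟶ one) : wordHom n (toHom f x) = f :=
  hom_ext_one (word_coord _)

theorem coord_inl (n m : GrOp) (i : Fin n.rank) :
    coord (n ⊗ m) (inl n m i) = fst n m ≫ coord n i :=
  hom_ext_one <| by
    rw [toHom_comp, coord, coord, word_coord, word_coord, toHom_fst_of]

theorem coord_inr (n m : GrOp) (i : Fin m.rank) :
    coord (n ⊗ m) (inr n m i) = snd n m ≫ coord m i :=
  hom_ext_one <| by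
    rw [toHom_comp, coord, coord, word_coord, word_coord, toHom_snd_of]

theorem coord_one (i : Fin one.rank) : coord one i = 𝟙 one :=
  hom_ext_one <| by
    rw [coord, word_coord, eq_idx i]; rfl

variable (P Q : GrOp ⥤ C) [Q.Monoidal]

open Functor

/-- Since the target is cartesian, `Q(n)` is the `n`-th power of `Q(1)`, with projections `Q(coord n
i)`. This is the uniqueness half of the universal property; `exists_monoidal_lift` is the existence
half. -/
theorem monoidal_hom_ext {Z : C} {n : GrOp} {f g : Z ⟶ Q.obj n}
    (h : ∀ i, f ≫ Q.map (coord n i) = g ≫ Q.map (coord n i)) : f = g := by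
  induction n using induction_tensor with
  | zero =>
    rw [← cancel_mono (OplaxMonoidal.η Q)]
    exact toUnit_unique _ _
  | succ n ih =>
    rw [← cancel_mono (OplaxMonoidal.δ Q n one)]
    apply CartesianMonoidalCategory.hom_ext
    · rw [Category.assoc, Category.assoc, OplaxMonoidal.δ_fst]
      refine ih fun i => ?_
      rw [Category.assoc, Category.assoc, ← Q.map_comp, ← coord_inl]
      exact h _
    · have := h (inr n one idx)
      rw [coord_inr, coord_one, Category.comp_id] at this
      rw [Category.assoc, Category.assoc, OplaxMonoidal.δ_snd, this]

theorem exists_monoidal_lift {Z : C} {n : GrOp} (g : Fin n.rank → (Z ⟶ Q.obj one)) :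
    ∃ f : Z ⟶ Q.obj n, ∀ i, f ≫ Q.map (coord n i) = g i := by
  induction n using induction_tensor with
  | zero => exact ⟨toUnit Z ≫ LaxMonoidal.ε Q, fun i : Fin 0 => i.elim0⟩
  | succ n ih =>
    obtain ⟨f, hf⟩ := ih fun i => g (inl n one i)
    refine ⟨lift f (g (inr n one idx)) ≫ LaxMonoidal.μ Q n one,
      inl_inr_cases (fun i => ?_) fun i => ?_⟩
    · rw [coord_inl, Category.assoc, Q.map_comp, Monoidal.μ_fst_assoc, lift_fst_assoc, hf]
    · rw [coord_inr, coord_one, Category.comp_id, Category.assoc, Monoidal.μ_snd, lift_snd,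
        eq_idx i]

open scoped Obj

/-- The component at `n` is the `n`-th power of `φ`. Compatibility with multiplication and unit is
enough for naturality: homomorphisms out of a free group are determined on generators, so inverses
need no hypothesis. -/
theorem exists_natTrans_app_one [P.Monoidal] (φ : P.obj one ⟶ Q.obj one) [IsMonHom φ] :
    ∃ τ : P ⟶ Q, τ.app one = φ := by
  choose τ hτ using fun n : GrOp =>
    exists_monoidal_lift Q fun i : Fin n.rank => P.map (coord n i) ≫ φ
  -- Naturality against morphisms to `1`. As functions of the word defining `f`, both sides are
  -- homomorphisms from `F_n`, and on the generators they agree by the choice of `τ n`.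
  have key (n : GrOp) (f : n ⟶ one) : P.map f ≫ φ = τ n ≫ Q.map f := by
    have h : ((IsMonHom.monoidHom φ (P.obj n)).comp (homMonoidHom P)).comp (wordHom n) =
        ((precompHom (τ n) (Q.obj one)).comp (homMonoidHom Q)).comp (wordHom n) :=
      FreeGroup.ext_hom _ _ fun i => (hτ n i).symm
    have := DFunLike.congr_fun h (toHom f x)
    simp only [MonoidHom.comp_apply, wordHom_toHom_x] at this
    exact this
  refine ⟨{ app := τ, naturality := fun n m f => monoidal_hom_ext Q fun i => ?_ }, ?_⟩
  · rw [Category.assoc, Category.assoc, ← Q.map_comp]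
    refine Eq.trans ?_ (key n _)
    refine (congrArg (fun q => P.map f ≫ q) (key m (coord m i)).symm).trans ?_
    rw [P.map_comp, Category.assoc]
  · have := key one (𝟙 one)
    rw [P.map_id, Q.map_id, Category.id_comp, Category.comp_id] at this
    exact this.symm

variable {P Q} in
theorem natTrans_ext_app_one {σ τ : P ⟶ Q} (h : σ.app one = τ.app one) : σ = τ := by
  ext n
  refine monoidal_hom_ext Q fun i => ?_
  refine (σ.naturality _).symm.trans (Eq.trans ?_ (τ.naturality _))
  rw [h]

end Extension

end GrOp

/-! ### Symmetric monoidal functors on a cartesian category -/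

theorem left_inv_eq_right_inv_hom {D : Type u} [Category.{v} D] {A B : D} {f g : A ⟶ B} {h : B ⟶ A}
    (hf : f ≫ h = 𝟙 A) (hg : h ≫ g = 𝟙 B) : f = g := by
  rw [← Category.comp_id f, ← hg, ← Category.assoc, hf, Category.id_comp]

namespace CocommComon

open Functor
open scoped ComonObj

variable {C : Type u} [Category.{v} C] [CartesianMonoidalCategory C] [BraidedCategory C]
  {D : Type w} [Category.{x} D] [MonoidalCategory D] [SymmetricCategory D]

/-- The diagonal of `X` is invariant under the swap, and a braided `F` carries swap to swap. -/
theorem isCocommComon_mapComon_obj (F : C ⥤ D) [F.Braided] (X : C) :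
    isCocommComon D ((cartesianComon C ⋙ F.mapComon).obj X) where
  comul_comm := by
    change (F.map (lift (𝟙 X) (𝟙 X)) ≫ OplaxMonoidal.δ F X X) ≫ (β_ (F.obj X) (F.obj X)).hom =
      F.map (lift (𝟙 X) (𝟙 X)) ≫ OplaxMonoidal.δ F X X
    rw [← cancel_mono (LaxMonoidal.μ F X X)]
    have h : lift (𝟙 X) (𝟙 X) ≫ (β_ X X).hom = lift (𝟙 X) (𝟙 X) := by ext <;> simp
    simp only [Category.assoc, Monoidal.δ_μ, Category.comp_id, ← LaxBraided.braided]
    rw [Monoidal.δ_μ_assoc, ← F.map_comp, h]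

/-- The functor to cocommutative comonoids defined by a symmetric monoidal functor on a cartesian
category. -/
def ofBraided (F : C ⥤ D) [F.Braided] : C ⥤ CocommComon D :=
  (isCocommComon D).lift (cartesianComon C ⋙ F.mapComon) (isCocommComon_mapComon_obj F)

variable (F G : C ⥤ D) [F.Braided] [G.Braided]

theorem isIso_of_hom_hom {A B : CocommComon D} (f : A ⟶ B) [h : IsIso f.hom.hom] : IsIso f := by
  have : IsIso ((forget D).map f) := h
  exact isIso_of_reflects_iso f (forget D)

/-- Hence the comparison is invertible because `F` is strong monoidal, so the lifted functor
preserves binary products. The next lemma does the same for the terminal object. -/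
theorem prodComparison_ofBraided_hom_hom (X Y : C) :
    (CartesianMonoidalCategory.prodComparison (ofBraided F) X Y).hom.hom =
      OplaxMonoidal.δ F X Y := by
  change (F.map (lift (𝟙 (X ⊗ Y)) (𝟙 (X ⊗ Y))) ≫ OplaxMonoidal.δ F _ _) ≫
    (F.map (fst X Y) ⊗ₘ F.map (snd X Y)) = _
  rw [Category.assoc, OplaxMonoidal.δ_natural, ← F.map_comp_assoc, lift_map, Category.id_comp,
    Category.id_comp, lift_fst_snd, F.map_id, Category.id_comp]

theorem terminalComparison_ofBraided_hom_hom :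
    (CartesianMonoidalCategory.terminalComparison (ofBraided F)).hom.hom =
      OplaxMonoidal.η F := by
  change F.map (toUnit (𝟙_ C)) ≫ OplaxMonoidal.η F = OplaxMonoidal.η F
  rw [toUnit_unit, F.map_id, Category.id_comp]

instance (X Y : C) : IsIso (CartesianMonoidalCategory.prodComparison (ofBraided F) X Y) :=
  isIso_of_hom_hom (h := by
    rw [prodComparison_ofBraided_hom_hom]
    exact inferInstanceAs (IsIso (OplaxMonoidal.δ F X Y))) _

instance : IsIso (CartesianMonoidalCategory.terminalComparison (ofBraided F)) :=
  isIso_of_hom_hom (h := by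
    rw [terminalComparison_ofBraided_hom_hom]
    exact inferInstanceAs (IsIso (OplaxMonoidal.η F))) _

instance : PreservesFiniteProducts (ofBraided F) :=
  preservesFiniteProducts_of_isIso_comparison _

noncomputable instance : (ofBraided F).Monoidal := .ofChosenFiniteProducts _

/-- The monoidal structure of `ofBraided F` was built from preservation of products. This and the
next three lemmas show that it lies over the given structure of `F`; `μ` and `ε` follow from `δ` and
`η` by uniqueness of inverses. -/
theorem δ_ofBraided_hom_hom (X Y : C) :
    (OplaxMonoidal.δ (ofBraided F) X Y).hom.hom = OplaxMonoidal.δ F X Y :=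
  prodComparison_ofBraided_hom_hom F X Y

theorem η_ofBraided_hom_hom :
    (OplaxMonoidal.η (ofBraided F)).hom.hom = OplaxMonoidal.η F :=
  terminalComparison_ofBraided_hom_hom F

theorem μ_ofBraided_hom_hom (X Y : C) :
    (LaxMonoidal.μ (ofBraided F) X Y).hom.hom = LaxMonoidal.μ F X Y := by
  have h : (LaxMonoidal.μ (ofBraided F) X Y).hom.hom ≫
      (OplaxMonoidal.δ (ofBraided F) X Y).hom.hom = 𝟙 (F.obj X ⊗ F.obj Y) :=
    congrArg (fun f => f.hom.hom) (Monoidal.μ_δ (ofBraided F) X Y)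
  rw [δ_ofBraided_hom_hom] at h
  exact left_inv_eq_right_inv_hom h (Monoidal.δ_μ F X Y)

theorem ε_ofBraided_hom_hom :
    (LaxMonoidal.ε (ofBraided F)).hom.hom = LaxMonoidal.ε F := by
  have h : (LaxMonoidal.ε (ofBraided F)).hom.hom ≫
      (OplaxMonoidal.η (ofBraided F)).hom.hom = 𝟙 (𝟙_ D) :=
    congrArg (fun f => f.hom.hom) (Monoidal.ε_η (ofBraided F))
  rw [η_ofBraided_hom_hom] at h
  exact left_inv_eq_right_inv_hom h (Monoidal.η_ε F)

variable {F G}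

/-- The natural transformation underlying one of functors to cocommutative comonoids. -/
def natTransOfBraided (σ : ofBraided F ⟶ ofBraided G) : F ⟶ G where
  app X := (σ.app X).hom.hom
  naturality _ _ f := congrArg (fun g => g.hom.hom) (σ.naturality f)

/-- Between product-preserving functors naturality alone forces compatibility with `δ`, as one sees
after composing with the projections. The statements for `μ` and `ε` follow by inverting `δ` and
`η`. -/
instance (σ : ofBraided F ⟶ ofBraided G) : NatTrans.IsMonoidal (natTransOfBraided σ) where
  unit := by
    rw [← cancel_mono (OplaxMonoidal.η G), Category.assoc, Monoidal.ε_η]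
    have h : σ.app (𝟙_ C) ≫ OplaxMonoidal.η (ofBraided G) = OplaxMonoidal.η (ofBraided F) :=
      toUnit_unique _ _
    have h' := congrArg (fun g => g.hom.hom) h
    change (natTransOfBraided σ).app (𝟙_ C) ≫ (OplaxMonoidal.η (ofBraided G)).hom.hom = _ at h'
    rw [η_ofBraided_hom_hom, η_ofBraided_hom_hom] at h'
    refine (congrArg (fun f => LaxMonoidal.ε F ≫ f) h').trans (Monoidal.ε_η F)
  tensor X Y := by
    rw [← cancel_mono (OplaxMonoidal.δ G X Y), Category.assoc, Category.assoc, Monoidal.μ_δ,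
      Category.comp_id, ← cancel_epi (OplaxMonoidal.δ F X Y), Monoidal.δ_μ_assoc]
    have h : σ.app (X ⊗ Y) ≫ OplaxMonoidal.δ (ofBraided G) X Y =
        OplaxMonoidal.δ (ofBraided F) X Y ≫ (σ.app X ⊗ₘ σ.app Y) := by
      apply CartesianMonoidalCategory.hom_ext
      · rw [Category.assoc, Category.assoc, OplaxMonoidal.δ_fst, tensorHom_fst,
          OplaxMonoidal.δ_fst_assoc, σ.naturality]
      · rw [Category.assoc, Category.assoc, OplaxMonoidal.δ_snd, tensorHom_snd,
          OplaxMonoidal.δ_snd_assoc, σ.naturality]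
    have h' := congrArg (fun g => g.hom.hom) h
    change (natTransOfBraided σ).app (X ⊗ Y) ≫ (OplaxMonoidal.δ (ofBraided G) X Y).hom.hom =
      (OplaxMonoidal.δ (ofBraided F) X Y).hom.hom ≫
        ((natTransOfBraided σ).app X ⊗ₘ (natTransOfBraided σ).app Y) at h'
    rw [δ_ofBraided_hom_hom, δ_ofBraided_hom_hom] at h'
    exact h'

/-- The components of a monoidal natural transformation are morphisms of comonoids. -/
theorem isComonHom_app (τ : F ⟶ G) [NatTrans.IsMonoidal τ] (X : C) :
    IsComonHom (M := ((ofBraided F).obj X).obj.X) (N := ((ofBraided G).obj X).obj.X)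
      (τ.app X) where
  hom_counit := by
    change τ.app X ≫ G.map (toUnit X) ≫ OplaxMonoidal.η G = F.map (toUnit X) ≫ OplaxMonoidal.η F
    rw [← NatTrans.naturality_assoc, ← cancel_mono (LaxMonoidal.ε G)]
    simp only [Category.assoc, Monoidal.η_ε, Category.comp_id]
    rw [← NatTrans.IsMonoidal.unit (τ := τ), Monoidal.η_ε_assoc]
  hom_comul := by
    change τ.app X ≫ G.map (lift (𝟙 X) (𝟙 X)) ≫ OplaxMonoidal.δ G X X =
      (F.map (lift (𝟙 X) (𝟙 X)) ≫ OplaxMonoidal.δ F X X) ≫ (τ.app X ⊗ₘ τ.app X)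
    rw [← NatTrans.naturality_assoc, ← cancel_mono (LaxMonoidal.μ G X X)]
    simp only [Category.assoc, Monoidal.δ_μ, Category.comp_id]
    rw [← NatTrans.IsMonoidal.tensor (τ := τ), Monoidal.δ_μ_assoc]

/-- A monoidal natural transformation as one of functors to cocommutative comonoids. -/
def mapOfBraided (τ : F ⟶ G) [NatTrans.IsMonoidal τ] : ofBraided F ⟶ ofBraided G where
  app X :=
    haveI := isComonHom_app τ X
    ofHom (A := (ofBraided F).obj X) (B := (ofBraided G).obj X) (τ.app X)
  naturality _ _ f := CocommComon.ext (τ.naturality f)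

end CocommComon

namespace CocommComon

/-! ### The monoidal structure after forgetting comonoid structures. -/

section CompForget

open Functor

variable {C : Type u} [Category.{v} C] [MonoidalCategory C]
  {D : Type w} [Category.{x} D] [MonoidalCategory D] [SymmetricCategory D]
  (P : C ⥤ CocommComon D) [P.Monoidal]

theorem μ_comp_forget (X Y : C) :
    LaxMonoidal.μ (P ⋙ forget D) X Y = (LaxMonoidal.μ P X Y).hom.hom := by
  rw [LaxMonoidal.comp_μ, LaxMonoidal.comp_μ]
  change (𝟙 _ ≫ 𝟙 _) ≫ _ = _
  rw [Category.comp_id]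
  exact Category.id_comp _

theorem δ_comp_forget (X Y : C) :
    OplaxMonoidal.δ (P ⋙ forget D) X Y = (OplaxMonoidal.δ P X Y).hom.hom := by
  rw [OplaxMonoidal.comp_δ, OplaxMonoidal.comp_δ]
  change _ ≫ 𝟙 _ ≫ 𝟙 _ = _
  rw [Category.comp_id]
  exact Category.comp_id _

theorem ε_comp_forget : LaxMonoidal.ε (P ⋙ forget D) = (LaxMonoidal.ε P).hom.hom := by
  rw [LaxMonoidal.comp_ε, LaxMonoidal.comp_ε]
  change (𝟙 _ ≫ 𝟙 _) ≫ _ = _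
  rw [Category.comp_id]
  exact Category.id_comp _

theorem η_comp_forget : OplaxMonoidal.η (P ⋙ forget D) = (OplaxMonoidal.η P).hom.hom := by
  rw [OplaxMonoidal.comp_η, OplaxMonoidal.comp_η]
  change _ ≫ 𝟙 _ ≫ 𝟙 _ = _
  rw [Category.comp_id]
  exact Category.comp_id _

end CompForget

end CocommComon

/-! ### Cocommutative Hopf monoids as group objects -/

namespace CocommComon

open scoped ComonObj MonObj

variable {D : Type u} [Category.{v} D] [MonoidalCategory D] [SymmetricCategory D]

theorem leftUnitor_hom_hom_hom (A : CocommComon D) : (λ_ A).hom.hom.hom = (λ_ A.obj.X).hom := by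
  change (λ_ A.obj).hom.hom = _
  rw [Comon.monoidal_leftUnitor_hom_hom]
  change 𝟙 (𝟙_ D) ▷ A.obj.X ≫ _ = _
  rw [MonoidalCategory.id_whiskerRight, Category.id_comp]

theorem rightUnitor_hom_hom_hom (A : CocommComon D) : (ρ_ A).hom.hom.hom = (ρ_ A.obj.X).hom := by
  change (ρ_ A.obj).hom.hom = _
  rw [Comon.monoidal_rightUnitor_hom_hom]
  change A.obj.X ◁ 𝟙 (𝟙_ D) ≫ _ = _
  rw [MonoidalCategory.whiskerLeft_id, Category.id_comp]

theorem associator_hom_hom_hom (A B E : CocommComon D) :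
    (α_ A B E).hom.hom.hom = (α_ A.obj.X B.obj.X E.obj.X).hom := by
  change (α_ A.obj B.obj E.obj).hom.hom = _
  rw [Comon.monoidal_associator_hom_hom]
  change 𝟙 (A.obj.X ⊗ B.obj.X) ▷ E.obj.X ≫ _ ≫ A.obj.X ◁ 𝟙 (B.obj.X ⊗ E.obj.X) = _
  rw [MonoidalCategory.whiskerLeft_id, MonoidalCategory.id_whiskerRight, Category.comp_id,
    Category.id_comp]

variable (A : D) [HopfObj A] [IsCommComonObj A]

/-- The unit of a cocommutative Hopf monoid, as a morphism of comonoids. -/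
def grpOne : 𝟙_ (CocommComon D) ⟶ of A :=
  ObjectProperty.homMk (Comon.Hom.mk (M := 𝟙_ (Comon D)) (N := ⟨A⟩) η[A] (isComonHom_hom :=
    { hom_counit := BimonObj.one_counit A
      hom_comul := BimonObj.one_comul A }))

/-- The multiplication of a cocommutative Hopf monoid, as a morphism of comonoids. -/
def grpMul : of A ⊗ of A ⟶ of A :=
  ObjectProperty.homMk (Comon.Hom.mk (M := Comon.mk A ⊗ Comon.mk A) (N := ⟨A⟩) μ[A]
    (isComonHom_hom :=
    { hom_counit := BimonObj.mul_counit A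
      hom_comul := by
        change μ[A] ≫ Δ[A] = Δ[A ⊗ A] ≫ (μ[A] ⊗ₘ μ[A])
        rw [Comon.tensorObj_comul, Category.assoc]
        exact BimonObj.mul_comul A }))

/-- The antipode of a cocommutative Hopf monoid, as a morphism of comonoids. -/
def grpInv : of A ⟶ of A :=
  ObjectProperty.homMk (Comon.Hom.mk (M := ⟨A⟩) (N := ⟨A⟩) (HopfObj.antipode (X := A))
    (isComonHom_hom :=
    { hom_counit := HopfObj.antipode_counit A
      hom_comul := by
        -- The antipode reverses the comultiplication; cocommutativity removes the swap.
        rw [HopfObj.antipode_comul, IsCommComonObj.comul_comm_assoc] }))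

/-- A cocommutative Hopf monoid is a group object in the category of cocommutative comonoids. -/
instance : GrpObj (of A) where
  one := grpOne A
  mul := grpMul A
  inv := grpInv A
  one_mul := CocommComon.ext <| by
    rw [leftUnitor_hom_hom_hom]; exact MonObj.one_mul A
  mul_one := CocommComon.ext <| by
    rw [rightUnitor_hom_hom_hom]; exact MonObj.mul_one A
  mul_assoc := CocommComon.ext <| by
    change μ[A] ▷ A ≫ μ[A] = (α_ (of A) (of A) (of A)).hom.hom.hom ≫ A ◁ μ[A] ≫ μ[A]
    rw [associator_hom_hom_hom]; exact MonObj.mul_assoc A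
  left_inv := CocommComon.ext <| by
    change (Δ[A] ≫ (HopfObj.antipode (X := A) ⊗ₘ 𝟙 A)) ≫ μ[A] = ε[A] ≫ η[A]
    rw [tensorHom_id, Category.assoc, HopfObj.antipode_left]
  right_inv := CocommComon.ext <| by
    change (Δ[A] ≫ (𝟙 A ⊗ₘ HopfObj.antipode (X := A))) ≫ μ[A] = ε[A] ≫ η[A]
    rw [id_tensorHom, Category.assoc, HopfObj.antipode_right]

end CocommComon

/-! ### Hopf algebras as Hopf monoids -/

section OfHopfAlgebra

variable {k : Type u} [CommRing k] (H : Type u) [Ring H] [HopfAlgebra k H]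

theorem tensorμ_mul' (s t : H ⊗[k] H) :
    (tensorμ (ModuleCat.of k H) (ModuleCat.of k H) (ModuleCat.of k H) (ModuleCat.of k H) ≫
      (ModuleCat.ofHom (LinearMap.mul' k H) ⊗ₘ ModuleCat.ofHom (LinearMap.mul' k H))).hom
        (s ⊗ₜ[k] t) = s * t := by
  induction s with
  | zero => rw [TensorProduct.zero_tmul, map_zero, zero_mul]
  | add s₁ s₂ h₁ h₂ => rw [TensorProduct.add_tmul, map_add, h₁, h₂, add_mul]
  | tmul a b =>
    induction t with
    | zero => rw [TensorProduct.tmul_zero, map_zero, mul_zero]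
    | add t₁ t₂ h₁ h₂ => rw [TensorProduct.tmul_add, map_add, h₁, h₂, mul_add]
    | tmul c d => rw [Algebra.TensorProduct.tmul_mul_tmul]; rfl

/-- The Hopf monoid of `Mod_k` defined by a Hopf algebra. -/
noncomputable instance : HopfObj (ModuleCat.of k H) where
  toMonObj := ModuleCat.MonModuleEquivalenceAlgebra.inverseObj (AlgCat.of k H)
  counit := ModuleCat.ofHom Coalgebra.counit
  comul := ModuleCat.ofHom Coalgebra.comul
  counit_comul := ModuleCat.hom_ext Coalgebra.rTensor_counit_comp_comul
  comul_counit := ModuleCat.hom_ext Coalgebra.lTensor_counit_comp_comul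
  comul_assoc := ModuleCat.hom_ext Coalgebra.coassoc.symm
  mul_comul := ModuleCat.hom_ext <| TensorProduct.ext' fun a b =>
    (Bialgebra.comul_mul a b).trans (tensorμ_mul' H _ _).symm
  one_comul := ModuleCat.hom_ext <| LinearMap.ext_ring <| by
    change Coalgebra.comul (R := k) (algebraMap k H 1) = algebraMap k H 1 ⊗ₜ[k] algebraMap k H 1
    rw [map_one, Bialgebra.comul_one, Algebra.TensorProduct.one_def]
  mul_counit := ModuleCat.hom_ext <| TensorProduct.ext' fun a b => Bialgebra.counit_mul a b
  one_counit := ModuleCat.hom_ext <| LinearMap.ext_ring <| by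
    change Coalgebra.counit (R := k) (algebraMap k H 1) = 1
    rw [map_one, Bialgebra.counit_one]
  antipode := ModuleCat.ofHom (HopfAlgebra.antipode k)
  antipode_left := ModuleCat.hom_ext HopfAlgebra.mul_antipode_rTensor_comul
  antipode_right := ModuleCat.hom_ext HopfAlgebra.mul_antipode_lTensor_comul

instance [h : Coalgebra.IsCocomm k H] : IsCommComonObj (ModuleCat.of k H) where
  comul_comm := ModuleCat.hom_ext h.comm_comp_comul

end OfHopfAlgebra

/-! ### Evaluation at `F_1` is an equivalence -/

namespace ExpFunctor

open Functor CocommComon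
open scoped ComonObj MonObj Obj

variable {k : Type u} [CommRing k]

instance : (ev₁ k).Faithful where
  map_injective {F G f g} h := by
    have h₁ (a : F.toFunctor.obj GrOp.one) : ((Hom.natTrans f).app GrOp.one).hom a =
        ((Hom.natTrans g).app GrOp.one).hom a :=
      congrArg (fun e => e.hom.toBialgHom a) h
    have h₂ : (Hom.natTrans f).app GrOp.one = (Hom.natTrans g).app GrOp.one :=
      ModuleCat.hom_ext (LinearMap.ext h₁)
    have h₃ : mapOfBraided (Hom.natTrans f) = mapOfBraided (Hom.natTrans g) :=
      GrOp.natTrans_ext_app_one (CocommComon.ext h₂)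
    -- Lifting a monoidal transformation to comonoids and forgetting again returns it
    -- definitionally.
    exact Hom.ext (congrArg natTransOfBraided h₃)

/-! ### Fullness: homomorphisms `F(1) → G(1)` as morphisms of group objects. -/

section Full

variable {F G : ExpFunctor k} (φ : F.ev₁Obj →ₐc[k] G.ev₁Obj)

/-- The linear map underlying a homomorphism of Hopf algebras `F(1) → G(1)`. -/
noncomputable def linearOfBialgHom : F.toFunctor.obj GrOp.one ⟶ G.toFunctor.obj GrOp.one :=
  ModuleCat.ofHom φ.toCoalgHom.toLinearMap

theorem isComonHom_linearOfBialgHom :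
    IsComonHom (M := ((ofBraided F.toFunctor).obj GrOp.one).obj.X)
      (N := ((ofBraided G.toFunctor).obj GrOp.one).obj.X) (linearOfBialgHom φ) where
  hom_counit := by
    have h : linearOfBialgHom φ ≫ G.toFunctor.map GrOp.counit ≫ OplaxMonoidal.η G.toFunctor =
        F.toFunctor.map GrOp.counit ≫ OplaxMonoidal.η F.toFunctor :=
      ModuleCat.hom_ext φ.counit_comp
    rw [GrOp.counit_eq] at h
    exact h
  hom_comul := by
    have h : linearOfBialgHom φ ≫ G.toFunctor.map GrOp.delta ≫ OplaxMonoidal.δ G.toFunctor _ _ =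
        (F.toFunctor.map GrOp.delta ≫ OplaxMonoidal.δ F.toFunctor _ _) ≫
          (linearOfBialgHom φ ⊗ₘ linearOfBialgHom φ) :=
      ModuleCat.hom_ext φ.map_comp_comul.symm
    rw [GrOp.delta_eq] at h
    exact h

/-- A homomorphism of Hopf algebras `F(1) → G(1)` as a morphism of cocommutative comonoids. -/
noncomputable def comonOfBialgHom :
    (ofBraided F.toFunctor).obj GrOp.one ⟶ (ofBraided G.toFunctor).obj GrOp.one :=
  haveI := isComonHom_linearOfBialgHom φ
  CocommComon.ofHom (A := (ofBraided F.toFunctor).obj GrOp.one)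
    (B := (ofBraided G.toFunctor).obj GrOp.one) (linearOfBialgHom φ)

theorem linearOfBialgHom_mul :
    (LaxMonoidal.μ F.toFunctor GrOp.one GrOp.one ≫ F.toFunctor.map GrOp.nabla) ≫
        linearOfBialgHom φ =
      (linearOfBialgHom φ ⊗ₘ linearOfBialgHom φ) ≫
        LaxMonoidal.μ G.toFunctor GrOp.one GrOp.one ≫ G.toFunctor.map GrOp.nabla :=
  ModuleCat.hom_ext <| TensorProduct.ext' fun a b => by
    exact map_mul (M := F.ev₁Obj) φ a b

theorem linearOfBialgHom_one :
    (LaxMonoidal.ε F.toFunctor ≫ F.toFunctor.map GrOp.unit) ≫ linearOfBialgHom φ =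
      LaxMonoidal.ε G.toFunctor ≫ G.toFunctor.map GrOp.unit :=
  ModuleCat.hom_ext <| LinearMap.ext_ring <| map_one φ

instance : IsMonHom (comonOfBialgHom φ) where
  one_hom := CocommComon.ext <| by
    change ((LaxMonoidal.ε (ofBraided F.toFunctor)).hom.hom ≫ F.toFunctor.map GrOp.unit) ≫
      linearOfBialgHom φ = (LaxMonoidal.ε (ofBraided G.toFunctor)).hom.hom ≫ _
    rw [ε_ofBraided_hom_hom, ε_ofBraided_hom_hom]
    exact linearOfBialgHom_one φ
  mul_hom := CocommComon.ext <| by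
    change ((LaxMonoidal.μ (ofBraided F.toFunctor) _ _).hom.hom ≫ F.toFunctor.map GrOp.nabla) ≫
      linearOfBialgHom φ = (linearOfBialgHom φ ⊗ₘ linearOfBialgHom φ) ≫
        (LaxMonoidal.μ (ofBraided G.toFunctor) _ _).hom.hom ≫ _
    rw [μ_ofBraided_hom_hom, μ_ofBraided_hom_hom]
    exact linearOfBialgHom_mul φ

end Full

instance : (ev₁ k).Full where
  map_surjective {F G} φ := by
    let ψ : F.ev₁Obj →ₐc[k] G.ev₁Obj := φ.hom.toBialgHom
    obtain ⟨τ, hτ⟩ := GrOp.exists_natTrans_app_one _ _ (comonOfBialgHom ψ)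
    refine ⟨⟨natTransOfBraided τ, inferInstance⟩, ?_⟩
    refine ObjectProperty.hom_ext _ (HopfAlgCat.Hom.ext (DFunLike.ext _ _ fun a => ?_))
    exact congrArg (fun e => e.hom.hom.hom a) hτ

/-! ### Essential surjectivity: the functor of tensor powers of a Hopf algebra. -/

section EssSurj

variable (H : Type u) [Ring H] [HopfAlgebra k H] [Coalgebra.IsCocomm k H]

/-- The functor `n ↦ H^{⊗ n}` to cocommutative comonoids defined by a cocommutative Hopf
algebra. -/
noncomputable def comonPower : GrOp ⥤ CocommComon (ModuleCat.{u} k) :=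
  GrOp.powerFunctor (CocommComon.of (ModuleCat.of k H))

noncomputable instance : (comonPower (k := k) H).Braided :=
  haveI : PreservesFiniteProducts (comonPower (k := k) H) :=
    inferInstanceAs (PreservesFiniteProducts (GrOp.powerFunctor _))
  .ofChosenFiniteProducts _

/-- The exponential functor `n ↦ H^{⊗ n}` defined by a cocommutative Hopf algebra. -/
noncomputable def tensorPower : ExpFunctor k where
  toFunctor := comonPower H ⋙ CocommComon.forget _
  braided := Functor.Braided.instComp _ _

/-- The isomorphism of the value at `F_1` with `H`. -/
noncomputable def tensorPowerOneIso :
    (comonPower (k := k) H).obj GrOp.one ≅ CocommComon.of (ModuleCat.of k H) :=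
  GrOp.powerOneIso _

theorem tensorPowerOneIso_mul :
    (LaxMonoidal.μ (comonPower (k := k) H) _ _ ≫ (comonPower H).map GrOp.nabla) ≫
        (tensorPowerOneIso H).hom =
      ((tensorPowerOneIso H).hom ⊗ₘ (tensorPowerOneIso H).hom) ≫ μ := by
  have h : (comonPower (k := k) H).map GrOp.nabla ≫ (tensorPowerOneIso H).hom =
      lift ((comonPower (k := k) H).map (fst _ _) ≫ (tensorPowerOneIso H).hom)
        ((comonPower (k := k) H).map (snd _ _) ≫ (tensorPowerOneIso H).hom) ≫ μ :=
    GrOp.map_nabla_powerOneIso _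
  rw [Category.assoc, h, ← Category.assoc]
  congr 1
  apply CartesianMonoidalCategory.hom_ext
  · rw [Category.assoc, lift_fst, Monoidal.μ_fst_assoc, tensorHom_fst]
  · rw [Category.assoc, lift_snd, Monoidal.μ_snd_assoc, tensorHom_snd]

theorem tensorPowerOneIso_one :
    (LaxMonoidal.ε (comonPower (k := k) H) ≫ (comonPower H).map GrOp.unit) ≫
        (tensorPowerOneIso H).hom = η := by
  have h : (comonPower (k := k) H).map GrOp.unit ≫ (tensorPowerOneIso H).hom = toUnit _ ≫ η :=
    GrOp.map_unit_powerOneIso _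
  rw [Category.assoc, h, ← Category.assoc, toUnit_unique (_ ≫ toUnit _) (𝟙 _), Category.id_comp]

theorem tensorPower_counit :
    (tensorPower (k := k) H).toFunctor.map GrOp.counit ≫
      OplaxMonoidal.η (tensorPower (k := k) H).toFunctor =
        (toUnit ((comonPower (k := k) H).obj GrOp.one)).hom.hom := by
  have h : (comonPower (k := k) H).map GrOp.counit ≫ OplaxMonoidal.η (comonPower (k := k) H) =
      toUnit _ := toUnit_unique _ _
  rw [← h]
  exact congrArg (fun f => (tensorPower (k := k) H).toFunctor.map GrOp.counit ≫ f)
    (η_comp_forget (comonPower (k := k) H))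

/-- The comultiplication of `1` in `gr^op` is its diagonal. A product-preserving functor takes it to
the diagonal in cocommutative comonoids, which is the comultiplication of the value at `1`. -/
theorem tensorPower_comul :
    (tensorPower (k := k) H).toFunctor.map GrOp.delta ≫
      OplaxMonoidal.δ (tensorPower (k := k) H).toFunctor GrOp.one GrOp.one =
        Δ[((comonPower (k := k) H).obj GrOp.one).obj.X] := by
  have h : (comonPower (k := k) H).map GrOp.delta ≫ OplaxMonoidal.δ (comonPower (k := k) H) _ _ =
      lift (𝟙 _) (𝟙 _) := by
    rw [GrOp.delta_eq, OplaxMonoidal.lift_δ, CategoryTheory.Functor.map_id]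
  have h₁ : (lift (𝟙 ((comonPower (k := k) H).obj GrOp.one))
      (𝟙 ((comonPower (k := k) H).obj GrOp.one))).hom.hom =
        Δ[((comonPower (k := k) H).obj GrOp.one).obj.X] :=
    (lift_hom_hom _ _).trans ((congrArg (fun f => Δ[((comonPower (k := k) H).obj _).obj.X] ≫ f)
      (id_tensorHom_id _ _)).trans (Category.comp_id _))
  rw [← h₁, ← h]
  exact congrArg (fun f => (tensorPower (k := k) H).toFunctor.map GrOp.delta ≫ f)
    (δ_comp_forget (comonPower (k := k) H) _ _)

theorem tensorPowerOneIso_counit :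
    (tensorPowerOneIso (k := k) H).hom.hom.hom ≫ ModuleCat.ofHom Coalgebra.counit =
      (tensorPower (k := k) H).toFunctor.map GrOp.counit ≫
        OplaxMonoidal.η (tensorPower (k := k) H).toFunctor := by
  rw [tensorPower_counit]
  exact IsComonHom.hom_counit (tensorPowerOneIso H).hom.hom.hom

theorem tensorPowerOneIso_comul :
    ((tensorPower (k := k) H).toFunctor.map GrOp.delta ≫
      OplaxMonoidal.δ (tensorPower (k := k) H).toFunctor GrOp.one GrOp.one) ≫
        ((tensorPowerOneIso (k := k) H).hom.hom.hom ⊗ₘ (tensorPowerOneIso (k := k) H).hom.hom.hom) =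
      (tensorPowerOneIso (k := k) H).hom.hom.hom ≫ ModuleCat.ofHom Coalgebra.comul := by
  rw [tensorPower_comul]
  exact (IsComonHom.hom_comul (tensorPowerOneIso H).hom.hom.hom).symm

/-- The homomorphism from the value at `F_1` to `H`. -/
noncomputable def tensorPowerOneHom : (tensorPower (k := k) H).ev₁Obj →ₐc[k] H where
  toLinearMap := (tensorPowerOneIso H).hom.hom.hom.hom
  counit_comp := ModuleCat.hom_ext_iff.mp (tensorPowerOneIso_counit (k := k) H)
  map_comp_comul := ModuleCat.hom_ext_iff.mp (tensorPowerOneIso_comul (k := k) H)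
  map_one' := by
    have h := congrArg (fun f => f.hom.hom) (tensorPowerOneIso_one (k := k) H)
    have h₁ := (congrArg (fun f => (f ≫ (tensorPower (k := k) H).toFunctor.map GrOp.unit) ≫
      (tensorPowerOneIso H).hom.hom.hom) (ε_comp_forget (comonPower (k := k) H))).trans h
    exact (ModuleCat.hom_congr h₁ (1 : k)).trans (map_one (algebraMap k H))
  map_mul' a b := by
    have h := congrArg (fun f => f.hom.hom) (tensorPowerOneIso_mul (k := k) H)
    have h₁ := (congrArg (fun f => (f ≫ (tensorPower (k := k) H).toFunctor.map GrOp.nabla) ≫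
      (tensorPowerOneIso H).hom.hom.hom) (μ_comp_forget (comonPower (k := k) H) _ _)).trans h
    exact ModuleCat.hom_congr h₁ (a ⊗ₜ[k] b)

theorem tensorPowerOneHom_bijective : Function.Bijective (tensorPowerOneHom (k := k) H) :=
  (((CocommComon.forget _).mapIso (tensorPowerOneIso (k := k) H)).toLinearEquiv).bijective

end EssSurj

instance : (ev₁ k).EssSurj where
  mem_essImage H := by
    have : Coalgebra.IsCocomm k H.obj := H.property
    exact ⟨tensorPower H.obj, ⟨(IsCocommHopf k).isoMk
      (BialgEquiv.ofBijective _ (tensorPowerOneHom_bijective (k := k) H.obj)).toHopfAlgIso⟩⟩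

instance : (ev₁ k).IsEquivalence where

end ExpFunctor

/-! ### Degree of elements relative to a morphism -/

namespace PolyFiltration

section Interchange

variable {C : Type v} [Category.{w} C] [CartesianMonoidalCategory C]

/-- The interchange `(X × S) × T ⟶ S × (X × T)`. -/
def interchange (X S T : C) : (X ⊗ S) ⊗ T ⟶ S ⊗ (X ⊗ T) :=
  lift (fst _ _ ≫ snd _ _) (lift (fst _ _ ≫ fst _ _) (snd _ _))

/-- The inverse of `interchange`. -/
def interchangeInv (X S T : C) : S ⊗ (X ⊗ T) ⟶ (X ⊗ S) ⊗ T :=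
  lift (lift (snd _ _ ≫ fst _ _) (fst _ _)) (snd _ _ ≫ snd _ _)

theorem interchange_interchangeInv (X S T : C) :
    interchange X S T ≫ interchangeInv X S T = 𝟙 _ := by
  rw [interchange, interchangeInv]
  ext <;> simp

/-- One copy of `X` is split off the iterated diagonal and made part of the parameter, which becomes
`X ⊗ T`. This matches the recursion in `degSub`. -/
theorem lift_diag_interchange (n : ℕ) {T X : C} (x : T ⟶ X) :
    lift (x ≫ diag X (n + 1)) (𝟙 T) ≫ interchange X (prodObj fun _ : Fin n => X) T =
      lift x (𝟙 T) ≫ lift ((snd X T ≫ x) ≫ diag X n) (𝟙 (X ⊗ T)) := by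
  change lift (x ≫ lift (𝟙 X) (diag X n)) (𝟙 T) ≫ lift _ _ = _
  ext <;> simp

end Interchange

variable {C : Type v} [Category.{w} C] [CartesianMonoidalCategory C] [HasZeroMorphisms C]
  {k : Type u} [CommRing k] (F : C ⥤ ModuleCat.{x} k)

/-- The difference of `F(x, 𝟙)` and `F(0, 𝟙)`, a map `F(T) → F(X × T)`. -/
def relDiff {T X : C} (x : T ⟶ X) : F.obj T →ₗ[k] F.obj (X ⊗ T) :=
  (F.map (lift x (𝟙 T))).hom - (F.map (lift 0 (𝟙 T))).hom

/-- The elements of `F(T)` of degree less than `n` in the variable `x : T ⟶ X`: those killed by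
the `n`-fold iteration of `relDiff`. -/
def degSub : (n : ℕ) → {T X : C} → (T ⟶ X) → Submodule k (F.obj T)
  | 0, _, _, _ => ⊥
  | n + 1, T, X, x => (degSub n (snd X T ≫ x)).comap (relDiff F x)

theorem mem_degSub_zero {T X : C} (x : T ⟶ X) (a : F.obj T) : a ∈ degSub F 0 x ↔ a = 0 := Iff.rfl

theorem mem_degSub_succ (n : ℕ) {T X : C} (x : T ⟶ X) (a : F.obj T) :
    a ∈ degSub F (n + 1) x ↔ relDiff F x a ∈ degSub F n (snd X T ≫ x) := Iff.rfl

theorem map_map_apply {C : Type v} [Category.{w} C] (F : C ⥤ ModuleCat.{x} k) {X Y Z : C}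
    (f : X ⟶ Y) (g : Y ⟶ Z) (a : F.obj X) :
    (F.map g).hom ((F.map f).hom a) = (F.map (f ≫ g)).hom a := by
  rw [F.map_comp]; rfl

theorem relDiff_apply {T X : C} (x : T ⟶ X) (a : F.obj T) :
    relDiff F x a = (F.map (lift x (𝟙 T))).hom a - (F.map (lift 0 (𝟙 T))).hom a := rfl

theorem relDiff_map {T T' X : C} (f : T ⟶ T') (x : T' ⟶ X) (a : F.obj T) :
    relDiff F x ((F.map f).hom a) = (F.map (X ◁ f)).hom (relDiff F (f ≫ x) a) := by
  rw [relDiff_apply, relDiff_apply, map_sub, map_map_apply, map_map_apply, map_map_apply,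
    map_map_apply]
  simp

theorem map_mem_degSub (n : ℕ) {T T' X : C} (f : T ⟶ T') (x : T' ⟶ X) {a : F.obj T}
    (ha : a ∈ degSub F n (f ≫ x)) : (F.map f).hom a ∈ degSub F n x := by
  induction n generalizing T T' with
  | zero =>
    rw [mem_degSub_zero] at ha ⊢
    rw [ha, map_zero]
  | succ n ih =>
    rw [mem_degSub_succ] at ha ⊢
    rw [relDiff_map]
    refine ih _ _ ?_
    rwa [whiskerLeft_snd_assoc]

theorem degSub_le_succ (n : ℕ) {T X : C} (x : T ⟶ X) : degSub F n x ≤ degSub F (n + 1) x := by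
  induction n generalizing T with
  | zero => exact bot_le
  | succ n ih => exact fun a ha => ih _ ha

theorem degSub_mono {T X : C} (x : T ⟶ X) : Monotone fun n => degSub F n x :=
  monotone_nat_of_le_succ fun n => degSub_le_succ F n x

/-- Telescoping: `F(x, y) - F(0, 0)` is the sum of `F(x, y) - F(0, y)` and `F(0, y) - F(0, 0)`, the
parameter `𝟙` being kept throughout. -/
theorem relDiff_lift {T X Y : C} (x : T ⟶ X) (y : T ⟶ Y) (a : F.obj T) :
    relDiff F (lift x y) a =
      (F.map (lift (lift (fst X T) (snd X T ≫ y)) (snd X T))).hom (relDiff F x a) +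
        (F.map (lift (lift 0 (fst Y T)) (snd Y T))).hom (relDiff F y a) := by
  rw [relDiff_apply, relDiff_apply, relDiff_apply, map_sub, map_sub, map_map_apply, map_map_apply,
    map_map_apply, map_map_apply]
  simp only [comp_lift, lift_fst, lift_snd, lift_snd_assoc, Category.id_comp, comp_zero]
  have h : (0 : T ⟶ X ⊗ Y) = lift 0 0 := by ext <;> simp
  rw [h]
  abel

/-- Degrees add: an element of degree less than `p` in `x` and less than `q` in `y` has degree less
than `p + q - 1` in `(x, y)`. -/
theorem mem_degSub_lift {n p q : ℕ} (h : p + q ≤ n + 1) {T X Y : C} (x : T ⟶ X) (y : T ⟶ Y)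
    {a : F.obj T} (hx : a ∈ degSub F p x) (hy : a ∈ degSub F q y) :
    a ∈ degSub F n (lift x y) := by
  induction n generalizing p q T with
  | zero =>
    -- Here `p + q ≤ 1`, so one of the degree bounds is zero and `a = 0`.
    rcases p with _ | p
    · exact hx
    · obtain rfl : q = 0 := by omega
      exact hy
  | succ n ih =>
    rcases p with _ | p
    · rw [(mem_degSub_zero F x a).1 hx]; exact zero_mem _
    rcases q with _ | q
    · rw [(mem_degSub_zero F y a).1 hy]; exact zero_mem _
    have hsnd : snd (X ⊗ Y) T ≫ lift x y = lift (snd (X ⊗ Y) T ≫ x) (snd (X ⊗ Y) T ≫ y) :=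
      comp_lift _ _ _
    rw [mem_degSub_succ, relDiff_lift, hsnd]
    -- Each telescoping summand drops by one in the variable that is differenced. It keeps its bound
    -- in the other, being a difference of two images of `a` under morphisms compatible with that
    -- variable.
    refine add_mem (ih (p := p) (q := q + 1) (by omega) _ _ ?_ ?_)
      (ih (p := p + 1) (q := q) (by omega) _ _ ?_ ?_)
    · refine map_mem_degSub F p _ _ ?_
      rw [lift_snd_assoc]
      exact hx
    · rw [relDiff_apply, map_sub, map_map_apply, map_map_apply]
      refine sub_mem (map_mem_degSub F _ _ _ ?_) (map_mem_degSub F _ _ _ ?_) <;>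
      simpa using hy
    · rw [relDiff_apply, map_sub, map_map_apply, map_map_apply]
      refine sub_mem (map_mem_degSub F _ _ _ ?_) (map_mem_degSub F _ _ _ ?_) <;>
      simpa using hx
    · refine map_mem_degSub F q _ _ ?_
      rw [lift_snd_assoc]
      exact hy

/-- The functor `F(- × T)`. -/
abbrev withParam (T : C) : C ⥤ ModuleCat.{x} k := tensorRight T ⋙ F

theorem chi_succ {n : ℕ} (X : Fin (n + 1) → C) :
    chi F X = idem F X 0 ∘ₗ (List.ofFn fun i : Fin n => idem F X i.succ).prod := by
  rw [chi, List.ofFn_succ, List.prod_cons]; rfl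

theorem map_injective_of_comp_eq_id {C : Type v} [Category.{w} C] (F : C ⥤ ModuleCat.{x} k) {X Y : C}
    {f : X ⟶ Y} {g : Y ⟶ X} (h : f ≫ g = 𝟙 X)
    {a : F.obj X} (ha : (F.map f).hom a = 0) : a = 0 := by
  have h' := map_map_apply F f g a
  rw [ha, map_zero, h, F.map_id] at h'
  exact h'.symm

theorem map_comp_id_sub {C : Type v} [Category.{w} C] (F : C ⥤ ModuleCat.{x} k) {A B : C}
    {f : A ⟶ B} {s : A ⟶ A} {t : B ⟶ B} (h : s ≫ f = f ≫ t) :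
    (F.map f).hom ∘ₗ (LinearMap.id - (F.map s).hom) =
      (LinearMap.id - (F.map t).hom) ∘ₗ (F.map f).hom := by
  rw [LinearMap.comp_sub, LinearMap.sub_comp, ← ModuleCat.hom_comp, ← ModuleCat.hom_comp,
    ← F.map_comp, ← F.map_comp, h]
  rfl

theorem id_sub_comp_id_sub {C : Type v} [Category.{w} C] (F : C ⥤ ModuleCat.{x} k) {A : C}
    {s t : A ⟶ A} (h : s ≫ t = t ≫ s) :
    (LinearMap.id - (F.map s).hom) ∘ₗ (LinearMap.id - (F.map t).hom) =
      (LinearMap.id - (F.map t).hom) ∘ₗ (LinearMap.id - (F.map s).hom) := by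
  rw [LinearMap.sub_comp, LinearMap.comp_sub _ _ (LinearMap.id - _), LinearMap.id_comp,
    LinearMap.comp_id, map_comp_id_sub F h.symm]

/-- Once the first factor is moved into the parameter, `e_1` acts on the parameter alone, so it
commutes with the remaining idempotents and can be applied before them. -/
theorem map_interchange_chi {n : ℕ} (X T : C) (v : F.obj ((X ⊗ prodObj fun _ : Fin n => X) ⊗ T)) :
    (F.map (interchange X (prodObj fun _ : Fin n => X) T)).hom
        (chi (withParam F T) (fun _ : Fin (n + 1) => X) v) =
      chi (withParam F (X ⊗ T)) (fun _ : Fin n => X)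
        ((F.map (interchange X (prodObj fun _ : Fin n => X) T)).hom v -
          (F.map (interchange X (prodObj fun _ : Fin n => X) T ≫
            (prodObj fun _ : Fin n => X) ◁ ((0 : X ⟶ X) ▷ T))).hom v) := by
  let S : C := prodObj fun _ : Fin n => X
  let Φ : F.obj ((X ⊗ S) ⊗ T) →ₗ[k] F.obj (S ⊗ (X ⊗ T)) := (F.map (interchange X S T)).hom
  let E : F.obj (S ⊗ (X ⊗ T)) →ₗ[k] F.obj (S ⊗ (X ⊗ T)) :=
    LinearMap.id - (F.map (S ◁ ((0 : X ⟶ X) ▷ T))).hom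
  have h₀ : Φ ∘ₗ idem (withParam F T) (fun _ : Fin (n + 1) => X) 0 = E ∘ₗ Φ := by
    refine map_comp_id_sub F (s := ((0 : X ⟶ X) ▷ S) ▷ T) ?_
    rw [interchange]
    ext <;> simp
  have h₁ : Φ ∘ₗ (List.ofFn fun i : Fin n =>
        idem (withParam F T) (fun _ : Fin (n + 1) => X) i.succ).prod =
      chi (withParam F (X ⊗ T)) (fun _ : Fin n => X) ∘ₗ Φ := by
    refine prod_comm _ _ _ fun i => ?_
    refine map_comp_id_sub F (s := (X ◁ tau (fun _ : Fin n => X) i) ▷ T)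
      (t := tau (fun _ : Fin n => X) i ▷ (X ⊗ T)) ?_
    rw [interchange]
    ext <;> simp [S]
  have h₂ : E ∘ₗ chi (withParam F (X ⊗ T)) (fun _ : Fin n => X) =
      chi (withParam F (X ⊗ T)) (fun _ : Fin n => X) ∘ₗ E := by
    refine prod_comm _ _ _ fun i => ?_
    exact id_sub_comp_id_sub F (t := tau (fun _ : Fin n => X) i ▷ (X ⊗ T)) (by ext <;> simp [S])
  have h₃ : chi (withParam F T) (fun _ : Fin (n + 1) => X) v =
      idem (withParam F T) (fun _ : Fin (n + 1) => X) 0 ((List.ofFn fun i : Fin n =>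
        idem (withParam F T) (fun _ : Fin (n + 1) => X) i.succ).prod v) :=
    LinearMap.congr_fun (chi_succ (withParam F T) fun _ : Fin (n + 1) => X) v
  refine (congrArg Φ h₃).trans ((LinearMap.congr_fun h₀ _).trans ?_)
  refine (congrArg E (LinearMap.congr_fun h₁ v)).trans ((LinearMap.congr_fun h₂ _).trans ?_)
  rw [← map_map_apply]
  rfl

/-- The `n`-fold difference is `χ` in `n` variables evaluated on the diagonal of `x`, with `T` kept
as a parameter. The induction moves one copy of `X` into the parameter, where its idempotent becomes
`relDiff`. -/
theorem mem_degSub_iff (n : ℕ) {T X : C} (x : T ⟶ X) (a : F.obj T) :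
    a ∈ degSub F n x ↔ chi (withParam F T) (fun _ : Fin n => X)
      ((F.map (lift (x ≫ diag X n) (𝟙 T))).hom a) = 0 := by
  induction n generalizing T with
  | zero =>
    refine ⟨fun h => ?_, fun h => ?_⟩
    · rw [(mem_degSub_zero F x a).1 h, map_zero, map_zero]
    · exact map_injective_of_comp_eq_id F (lift_snd _ _) h
  | succ n ih =>
    have h := map_interchange_chi F X T ((F.map (lift (x ≫ diag X (n + 1)) (𝟙 T))).hom a)
    have h₀ : lift x (𝟙 T) ≫ lift ((snd X T ≫ x) ≫ diag X n) (𝟙 (X ⊗ T)) ≫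
        (prodObj fun _ : Fin n => X) ◁ ((0 : X ⟶ X) ▷ T) =
      lift 0 (𝟙 T) ≫ lift ((snd X T ≫ x) ≫ diag X n) (𝟙 (X ⊗ T)) := by
      ext <;> simp
    have h₁ : (F.map (interchange X (prodObj fun _ : Fin n => X) T)).hom
          ((F.map (lift (x ≫ diag X (n + 1)) (𝟙 T))).hom a) =
        (F.map (lift ((snd X T ≫ x) ≫ diag X n) (𝟙 (X ⊗ T)))).hom
          ((F.map (lift x (𝟙 T))).hom a) := by
      refine (map_map_apply F _ _ a).trans ?_
      rw [map_map_apply]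
      exact congrArg (fun f => (F.map f).hom a) (lift_diag_interchange n x)
    have h₂ : (F.map (interchange X (prodObj fun _ : Fin n => X) T ≫
            (prodObj fun _ : Fin n => X) ◁ ((0 : X ⟶ X) ▷ T))).hom
          ((F.map (lift (x ≫ diag X (n + 1)) (𝟙 T))).hom a) =
        (F.map (lift ((snd X T ≫ x) ≫ diag X n) (𝟙 (X ⊗ T)))).hom
          ((F.map (lift 0 (𝟙 T))).hom a) := by
      refine (map_map_apply F (interchange X (prodObj fun _ : Fin n => X) T) _ _).symm.trans ?_
      refine (congrArg (F.map ((prodObj fun _ : Fin n => X) ◁ ((0 : X ⟶ X) ▷ T))).hom h₁).trans ?_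
      rw [map_map_apply, map_map_apply, map_map_apply, ← h₀]
    have h₃ := h.trans (congrArg (chi (withParam F (X ⊗ T)) (fun _ : Fin n => X))
      (congrArg₂ (· - ·) h₁ h₂))
    rw [← map_sub, ← relDiff_apply] at h₃
    rw [mem_degSub_succ, ih]
    refine ⟨fun h' => ?_, fun h' => ?_⟩
    · exact map_injective_of_comp_eq_id F (interchange_interchangeInv _ _ _) (h₃.trans h')
    · exact h₃.symm.trans ((congrArg (F.map (interchange X _ T)).hom h').trans (map_zero _))

/-- Projecting away the parameter carries the relative `χ` to the absolute one. The shift occurs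
because `degSub` counts degree less than its index. -/
theorem degSub_le_polySub (n : ℕ) (X : C) : degSub F (n + 1) (𝟙 X) ≤ polySub F n X := by
  intro a ha
  rw [mem_degSub_iff] at ha
  let S : C := prodObj fun _ : Fin (n + 1) => X
  have h : (F.map (fst S X)).hom ∘ₗ chi (withParam F X) (fun _ : Fin (n + 1) => X) =
      chi F (fun _ : Fin (n + 1) => X) ∘ₗ (F.map (fst S X)).hom :=
    prod_comm _ _ _ fun i => map_comp_id_sub F (s := tau (fun _ : Fin (n + 1) => X) i ▷ X)
      (t := tau (fun _ : Fin (n + 1) => X) i) (whiskerRight_fst _ _)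
  have h₁ := LinearMap.congr_fun h ((F.map (lift (𝟙 X ≫ diag X (n + 1)) (𝟙 X))).hom a)
  have h₂ : (F.map (fst S X)).hom ((F.map (lift (𝟙 X ≫ diag X (n + 1)) (𝟙 X))).hom a) =
      (F.map (diag X (n + 1))).hom a := by
    rw [map_map_apply, lift_fst, Category.id_comp]
  change chi F (fun _ : Fin (n + 1) => X) ((F.map (diag X (n + 1))).hom a) = 0
  rw [← h₂]
  exact h₁.symm.trans ((congrArg (F.map (fst S X)).hom ha).trans (map_zero _))

/-- The parameter is one more copy of `X` to which no idempotent is applied. With `Q` the product of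
the other idempotents and `v` the image of `a` under the diagonal into `n + 2` factors, the goal is
`Q v = 0`. It holds because both `e_1 (Q v)` and `F(τ_1)(Q v)` vanish. -/
theorem polySub_le_degSub (n : ℕ) (X : C) : polySub F n X ≤ degSub F (n + 1) (𝟙 X) := by
  intro a ha
  rw [mem_degSub_iff]
  let S : C := prodObj fun _ : Fin (n + 1) => X
  let r : S ⊗ X ⟶ X ⊗ S := lift (snd _ _) (fst _ _)
  let Q : F.obj (X ⊗ S) →ₗ[k] F.obj (X ⊗ S) :=
    (List.ofFn fun i : Fin (n + 1) => idem F (fun _ : Fin (n + 2) => X) i.succ).prod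
  have h : (F.map r).hom ∘ₗ chi (withParam F X) (fun _ : Fin (n + 1) => X) = Q ∘ₗ (F.map r).hom :=
    prod_comm _ _ _ fun i => map_comp_id_sub F (s := tau (fun _ : Fin (n + 1) => X) i ▷ X)
      (t := X ◁ tau (fun _ : Fin (n + 1) => X) i) (by ext <;> simp [r, S])
  have h' : (F.map (lift 0 (𝟙 S) : S ⟶ X ⊗ S)).hom ∘ₗ chi F (fun _ : Fin (n + 1) => X) =
      Q ∘ₗ (F.map (lift 0 (𝟙 S) : S ⟶ X ⊗ S)).hom :=
    prod_comm _ _ _ fun i => map_comp_id_sub F (s := tau (fun _ : Fin (n + 1) => X) i)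
      (t := X ◁ tau (fun _ : Fin (n + 1) => X) i) (by ext <;> simp [S])
  have h'' : (F.map ((0 : X ⟶ X) ▷ S)).hom ∘ₗ Q = Q ∘ₗ (F.map ((0 : X ⟶ X) ▷ S)).hom :=
    prod_comm _ _ _ fun i => map_comp_id_sub F (s := X ◁ tau (fun _ : Fin (n + 1) => X) i)
      (t := X ◁ tau (fun _ : Fin (n + 1) => X) i) (by ext <;> simp [S])
  have h₁ := LinearMap.congr_fun h ((F.map (lift (𝟙 X ≫ diag X (n + 1)) (𝟙 X))).hom a)
  have h₂ : (F.map r).hom ((F.map (lift (𝟙 X ≫ diag X (n + 1)) (𝟙 X))).hom a) =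
      (F.map (lift (𝟙 X) (diag X (n + 1)))).hom a := by
    rw [map_map_apply, Category.id_comp, comp_lift, lift_snd, lift_fst]
  have ha' : chi F (fun _ : Fin (n + 1) => X) ((F.map (diag X (n + 1))).hom a) = 0 := ha
  -- This is `e_1 (Q v) = 0`, valid because `a` also lies in the next term of the filtration.
  have h₃ : Q ((F.map (lift (𝟙 X) (diag X (n + 1)))).hom a) -
      (F.map ((0 : X ⟶ X) ▷ S)).hom (Q ((F.map (lift (𝟙 X) (diag X (n + 1)))).hom a)) = 0 := by
    have := polySub_le_succ F n X ha
    rw [polySub, LinearMap.mem_ker, chiDiag, chi_succ] at this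
    exact this
  have h₄ :
      (F.map ((0 : X ⟶ X) ▷ S)).hom (Q ((F.map (lift (𝟙 X) (diag X (n + 1)))).hom a)) = 0 := by
    -- `F(τ_1)` commutes with `Q` and replaces the first coordinate by zero, which leaves the image
    -- of `χ` in `n + 1` variables, and that kills `a`.
    refine (LinearMap.congr_fun h'' _).trans ?_
    have h₅ : (F.map ((0 : X ⟶ X) ▷ S)).hom ((F.map (lift (𝟙 X) (diag X (n + 1)))).hom a) =
        (F.map (lift 0 (𝟙 S) : S ⟶ X ⊗ S)).hom ((F.map (diag X (n + 1))).hom a) := by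
      rw [map_map_apply, map_map_apply]
      congr 3
      ext <;> simp [S]
    refine (congrArg Q h₅).trans ((LinearMap.congr_fun h' _).symm.trans ?_)
    exact (congrArg (F.map (lift 0 (𝟙 S) : S ⟶ X ⊗ S)).hom ha').trans (map_zero _)
  rw [h₄, sub_zero] at h₃
  refine map_injective_of_comp_eq_id F (f := r) (g := lift (snd _ _) (fst _ _))
    (by ext <;> simp [r]) ?_
  exact h₁.trans ((congrArg Q h₂).trans h₃)

end PolyFiltration

/-! ### Analyticity in terms of elements -/

namespace PolyFiltration

variable {C : Type v} [Category.{w} C] [CartesianMonoidalCategory C] [HasZeroMorphisms C]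
  {k : Type u} [CommRing k] (F : C ⥤ ModuleCat.{x} k)

theorem mem_iSup_polySub {X : C} {a : F.obj X} :
    a ∈ ⨆ n, polySub F n X ↔ ∃ n, a ∈ polySub F n X :=
  Submodule.mem_iSup_of_directed _ (polySub_mono F X).directed_le

theorem map_mem_iSup_polySub {X Y : C} (f : X ⟶ Y) {a : F.obj X} (ha : a ∈ ⨆ n, polySub F n X) :
    (F.map f).hom a ∈ ⨆ n, polySub F n Y := by
  rw [mem_iSup_polySub] at ha ⊢
  exact ha.imp fun n h => map_mem_polySub F n f h

/-- The union of the polynomial filtration of `F`. -/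
def polyUnion : C ⥤ ModuleCat.{x} k where
  obj X := ModuleCat.of k (⨆ n, polySub F n X : Submodule k (F.obj X))
  map f := ModuleCat.ofHom
    (LinearMap.restrict (F.map f).hom fun _ ha => map_mem_iSup_polySub F f ha)
  map_id X := ModuleCat.hom_ext <| LinearMap.ext fun a =>
    Subtype.ext (ModuleCat.hom_congr (F.map_id X) a.1)
  map_comp f g := ModuleCat.hom_ext <| LinearMap.ext fun a =>
    Subtype.ext (ModuleCat.hom_congr (F.map_comp f g) a.1)

/-- The inclusion of the union of the polynomial filtration in `F`. -/
def polyUnionIncl : polyUnion F ⟶ F where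
  app X := ModuleCat.ofHom (⨆ n, polySub F n X : Submodule k (F.obj X)).subtype

/-- The union of the polynomial filtration as a cocone. -/
def polyUnionCocone : Cocone (polyFiltration F) where
  pt := polyUnion F
  ι :=
    { app := fun n =>
        { app := fun X => ModuleCat.ofHom
            (Submodule.inclusion (le_iSup (fun n => polySub F n X) n)) } }

section Desc

variable {F} (h : ∀ (X : C) (a : F.obj X), ∃ n, a ∈ polySub F n X) (s : Cocone (polyFiltration F))

theorem cocone_app_eq {X : C} {a : F.obj X} {m n : ℕ} (hm : a ∈ polySub F m X)
    (hn : a ∈ polySub F n X) :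
    ((s.ι.app m).app X).hom ⟨a, hm⟩ = ((s.ι.app n).app X).hom ⟨a, hn⟩ := by
  wlog hmn : m ≤ n generalizing m n
  · exact (this hn hm (le_of_not_ge hmn)).symm
  have h := congrArg (fun e : (polyFiltration F).obj m ⟶ s.pt => e.app X) (s.w (homOfLE hmn))
  exact (ModuleCat.hom_congr h (⟨a, hm⟩ : polySub F m X)).symm

/-- The linear map `F(X) → S(X)` defined by a cocone under the polynomial filtration, if each
element of `F(X)` lies in some term of the filtration. -/
noncomputable def descLinear (X : C) : F.obj X →ₗ[k] s.pt.obj X where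
  toFun a := ((s.ι.app (h X a).choose).app X).hom ⟨a, (h X a).choose_spec⟩
  map_add' a b := by
    let m := max (h X a).choose (h X b).choose
    have ha : a ∈ polySub F m X := polySub_mono F X (le_max_left _ _) (h X a).choose_spec
    have hb : b ∈ polySub F m X := polySub_mono F X (le_max_right _ _) (h X b).choose_spec
    rw [cocone_app_eq s _ (add_mem ha hb), cocone_app_eq s (h X a).choose_spec ha,
      cocone_app_eq s (h X b).choose_spec hb]
    exact map_add ((s.ι.app m).app X).hom ⟨a, ha⟩ ⟨b, hb⟩
  map_smul' r a := by
    rw [cocone_app_eq s _ (Submodule.smul_mem _ r (h X a).choose_spec)]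
    exact map_smul ((s.ι.app (h X a).choose).app X).hom r ⟨a, (h X a).choose_spec⟩

theorem descLinear_apply {X : C} {a : F.obj X} {n : ℕ} (ha : a ∈ polySub F n X) :
    descLinear h s X a = ((s.ι.app n).app X).hom ⟨a, ha⟩ :=
  cocone_app_eq s _ ha

/-- The morphism `F ⟶ S` defined by a cocone under the polynomial filtration. -/
noncomputable def desc : F ⟶ s.pt where
  app X := ModuleCat.ofHom (descLinear h s X)
  naturality X Y f := ModuleCat.hom_ext <| LinearMap.ext fun a => by
    obtain ⟨n, ha⟩ := h X a
    change descLinear h s Y ((F.map f).hom a) = (s.pt.map f).hom (descLinear h s X a)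
    rw [descLinear_apply h s ha, descLinear_apply h s (map_mem_polySub F n f ha)]
    exact ModuleCat.hom_congr ((s.ι.app n).naturality f) ⟨a, ha⟩

end Desc

/-- If `F` is the colimit, the induced map from `F` to the union followed by the inclusion is the
identity, so the union is everything. Conversely, a cocone is glued elementwise, on any term
containing the element. -/
theorem isAnalytic_iff : IsAnalytic F ↔ ∀ (X : C) (a : F.obj X), ∃ n, a ∈ polySub F n X := by
  refine ⟨fun ⟨hF⟩ X a => ?_, fun h => ⟨?_⟩⟩
  · have h : hF.desc (polyUnionCocone F) ≫ polyUnionIncl F = 𝟙 F :=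
      hF.hom_ext fun n => (Category.assoc _ _ _).symm.trans
        (congrArg (fun e => e ≫ polyUnionIncl F) (hF.fac (polyUnionCocone F) n))
    have h' := ModuleCat.hom_congr (congrArg (fun e => e.app X) h) a
    rw [← mem_iSup_polySub]
    have h'' : (((hF.desc (polyUnionCocone F)).app X).hom a).1 = a := h'
    rw [← h'']
    exact (((hF.desc (polyUnionCocone F)).app X).hom a).2
  · exact
      { desc := fun s => desc h s
        fac := fun s n => by
          ext X a
          exact descLinear_apply h s a.2
        uniq := fun s m hm => by
          ext X a
          obtain ⟨n, ha⟩ := h X a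
          refine Eq.trans ?_ (descLinear_apply h s ha).symm
          have h' := congrArg (fun e : (polyFiltration F).obj n ⟶ s.pt => e.app X) (hm n)
          exact ModuleCat.hom_congr h' (⟨a, ha⟩ : polySub F n X) }

end PolyFiltration

/-! ### Degrees of elements of exponential functors -/

namespace PolyFiltration

open Functor.LaxMonoidal

variable {C : Type v} [Category.{w} C] [CartesianMonoidalCategory C] [HasZeroMorphisms C]
  {k : Type u} [CommRing k] (F : C ⥤ ModuleCat.{u} k)

theorem map_whiskerRight_mu {C : Type v} [Category.{w} C] [MonoidalCategory C]
    (F : C ⥤ ModuleCat.{u} k) [F.LaxMonoidal] {T T' : C} (f : T ⟶ T') (U : C) (a : F.obj T)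
    (b : F.obj U) : (F.map (f ▷ U)).hom ((μ F T U).hom (a ⊗ₜ[k] b)) =
      (μ F T' U).hom ((F.map f).hom a ⊗ₜ[k] b) :=
  (ModuleCat.hom_congr (μ_natural_left F f U) (a ⊗ₜ[k] b)).symm

theorem relDiff_mu [F.LaxMonoidal] {T X : C} (x : T ⟶ X) (U : C) (a : F.obj T) (b : F.obj U) :
    relDiff F (fst T U ≫ x) ((μ F T U).hom (a ⊗ₜ[k] b)) =
      (F.map (α_ X T U).hom).hom ((μ F (X ⊗ T) U).hom (relDiff F x a ⊗ₜ[k] b)) := by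
  have h (y : T ⟶ X) : lift (fst T U ≫ y) (𝟙 (T ⊗ U)) = lift y (𝟙 T) ▷ U ≫ (α_ X T U).hom := by
    ext <;> simp
  have h₀ : lift (0 : T ⊗ U ⟶ X) (𝟙 (T ⊗ U)) = lift 0 (𝟙 T) ▷ U ≫ (α_ X T U).hom := by
    rw [← h, comp_zero]
  rw [relDiff_apply, h, h₀, ← map_map_apply, ← map_map_apply, map_whiskerRight_mu,
    map_whiskerRight_mu, ← map_sub, ← map_sub, ← TensorProduct.sub_tmul]
  rfl

theorem mu_mem_degSub_fst [F.LaxMonoidal] (n : ℕ) {T X : C} (x : T ⟶ X) (U : C) {a : F.obj T}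
    (ha : a ∈ degSub F n x) (b : F.obj U) :
    (μ F T U).hom (a ⊗ₜ[k] b) ∈ degSub F n (fst T U ≫ x) := by
  induction n generalizing T with
  | zero =>
    rw [mem_degSub_zero] at ha ⊢
    rw [ha, TensorProduct.zero_tmul]
    exact map_zero _
  | succ n ih =>
    rw [mem_degSub_succ] at ha ⊢
    rw [relDiff_mu]
    refine map_mem_degSub F n _ _ ?_
    rw [associator_hom_snd_fst_assoc]
    exact ih _ ha

variable [BraidedCategory C]

/-- The symmetry reduces this to the case of the first factor. -/
theorem mu_mem_degSub_snd [F.LaxBraided] (n : ℕ) {T X : C} (x : T ⟶ X) (U : C) {a : F.obj T}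
    (ha : a ∈ degSub F n x) (b : F.obj U) :
    (μ F U T).hom (b ⊗ₜ[k] a) ∈ degSub F n (snd U T ≫ x) := by
  have h : (F.map (β_ T U).hom).hom ((μ F T U).hom (a ⊗ₜ[k] b)) = (μ F U T).hom (b ⊗ₜ[k] a) :=
    ModuleCat.hom_congr (Functor.LaxBraided.braided (F := F) T U) (a ⊗ₜ[k] b)
  rw [← h]
  refine map_mem_degSub F n _ _ ?_
  rw [← Category.assoc, braiding_hom_snd]
  exact mu_mem_degSub_fst F n x U ha b

/-- If each element of `F(X)` and of `F(Y)` has finite degree, then so does each element of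
`F(X × Y)`. -/
theorem exists_mem_degSub_tensor [F.Braided] {X Y : C}
    (hX : ∀ a : F.obj X, ∃ n, a ∈ degSub F n (𝟙 X))
    (hY : ∀ a : F.obj Y, ∃ n, a ∈ degSub F n (𝟙 Y)) (c : F.obj (X ⊗ Y)) :
    ∃ n, c ∈ degSub F n (𝟙 (X ⊗ Y)) := by
  have h (t : F.obj X ⊗[k] F.obj Y) : ∃ n, (μ F X Y).hom t ∈ degSub F n (𝟙 (X ⊗ Y)) := by
    induction t with
    | zero => exact ⟨0, map_zero _⟩
    | add s t hs ht =>
      obtain ⟨m, hm⟩ := hs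
      obtain ⟨n, hn⟩ := ht
      refine ⟨max m n, ?_⟩
      have := add_mem (degSub_mono F _ (le_max_left m n) hm) (degSub_mono F _ (le_max_right m n) hn)
      rwa [← map_add] at this
    | tmul a b =>
      obtain ⟨m, hm⟩ := hX a
      obtain ⟨n, hn⟩ := hY b
      -- One more than addition of degrees gives, which avoids truncated subtraction. The identity
      -- of `X ⊗ Y` is next read as the pair of projections.
      refine ⟨m + n, ?_⟩
      rw [← lift_fst_snd]
      refine mem_degSub_lift F (p := m) (q := n) (by omega) _ _ ?_ ?_
      · simpa using mu_mem_degSub_fst F m (𝟙 X) Y hm b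
      · simpa using mu_mem_degSub_snd F n (𝟙 Y) X hn a
  obtain ⟨n, hn⟩ := h ((Functor.OplaxMonoidal.δ F X Y).hom c)
  refine ⟨n, ?_⟩
  have h' : (μ F X Y).hom ((Functor.OplaxMonoidal.δ F X Y).hom c) = c :=
    ModuleCat.hom_congr (Functor.Monoidal.δ_μ F X Y) c
  rwa [h'] at hn

end PolyFiltration

/-- Every `F(n)` is an iterated tensor product of copies of `F(1)`, and finiteness of degree is
stable under tensor products. -/
theorem GrOp.isAnalytic_of_polySub_one {k : Type u} [CommRing k] (F : GrOp ⥤ ModuleCat.{u} k)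
    [F.Braided] (h : ∀ a : F.obj one, ∃ n, a ∈ PolyFiltration.polySub F n one) :
    PolyFiltration.IsAnalytic F := by
  rw [PolyFiltration.isAnalytic_iff]
  have h' (X : GrOp) : ∀ a : F.obj X, ∃ n, a ∈ PolyFiltration.degSub F n (𝟙 X) := by
    induction X using induction_tensor with
    | zero =>
      -- On the null object zero and identity coincide, so the first difference already vanishes.
      refine fun a => ⟨1, ?_⟩
      rw [PolyFiltration.mem_degSub_succ, PolyFiltration.mem_degSub_zero,
        PolyFiltration.relDiff_apply, toUnit_unique (0 : 𝟙_ GrOp ⟶ 𝟙_ GrOp) (𝟙 _), sub_self]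
    | succ n ih =>
      exact PolyFiltration.exists_mem_degSub_tensor F ih fun a =>
        (h a).elim fun m hm => ⟨m + 1, PolyFiltration.polySub_le_degSub F m one hm⟩
  intro X a
  obtain ⟨n, hn⟩ := h' X a
  exact ⟨n, PolyFiltration.degSub_le_polySub F n X (PolyFiltration.degSub_le_succ F n _ hn)⟩

/-! ### Polynomial filtration and coradical filtration -/

namespace PolyFiltration

open Functor.LaxMonoidal Functor.OplaxMonoidal Functor.Monoidal Coradical

variable {C : Type v} [Category.{w} C] [CartesianMonoidalCategory C]
  {k : Type u} [CommRing k] (F : C ⥤ ModuleCat.{u} k) [F.Monoidal]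

section Powers

variable {X : C} {M : ModuleCat.{u} k} (i : M ⟶ F.obj X) (p : F.obj X ⟶ M)

/-- The projection `F(X^{n+1}) ⟶ M^{⊗ (n+1)}` defined by `p : F(X) ⟶ M`. -/
def powProj : (n : ℕ) → (F.obj (prodObj fun _ : Fin (n + 1) => X) ⟶ tensorPow M n)
  | 0 => F.map (ρ_ X).hom ≫ p
  | n + 1 => δ F X (prodObj fun _ : Fin (n + 1) => X) ≫ (p ⊗ₘ powProj n)

/-- The inclusion `M^{⊗ (n+1)} ⟶ F(X^{n+1})` defined by `i : M ⟶ F(X)`. -/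
def powIncl : (n : ℕ) → (tensorPow M n ⟶ F.obj (prodObj fun _ : Fin (n + 1) => X))
  | 0 => i ≫ F.map (ρ_ X).inv
  | n + 1 => (i ⊗ₘ powIncl n) ≫ μ F X (prodObj fun _ : Fin (n + 1) => X)

variable {i p}

theorem powIncl_powProj (hip : i ≫ p = 𝟙 M) (n : ℕ) : powIncl F i n ≫ powProj F p n = 𝟙 _ := by
  induction n with
  | zero =>
    change (i ≫ F.map (ρ_ X).inv) ≫ F.map (ρ_ X).hom ≫ p = 𝟙 M
    rw [Category.assoc, ← F.map_comp_assoc, Iso.inv_hom_id, F.map_id, Category.id_comp, hip]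
  | succ n ih =>
    change ((i ⊗ₘ powIncl F i n) ≫ μ F X (prodObj fun _ : Fin (n + 1) => X)) ≫
      δ F X (prodObj fun _ : Fin (n + 1) => X) ≫ (p ⊗ₘ powProj F p n) = 𝟙 (M ⊗ tensorPow M n)
    rw [Category.assoc, μ_δ_assoc, tensorHom_comp_tensorHom, hip, ih, id_tensorHom_id]

end Powers

variable [HasZeroMorphisms C]

/-- By naturality of `μ`, `e_1` acts on the left tensor factor as `id - F(0)` and the other
idempotents act on the right one. So `χ` is a tensor product of operators. -/
theorem chi_mu {n : ℕ} (X : Fin (n + 1) → C) (a : F.obj (X 0))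
    (b : F.obj (prodObj fun i : Fin n => X i.succ)) :
    chi F X ((μ F (X 0) (prodObj fun i : Fin n => X i.succ)).hom (a ⊗ₜ[k] b)) =
      (μ F (X 0) (prodObj fun i : Fin n => X i.succ)).hom
        ((a - (F.map (0 : X 0 ⟶ X 0)).hom a) ⊗ₜ[k] chi F (fun i : Fin n => X i.succ) b) := by
  let S : C := prodObj fun i : Fin n => X i.succ
  let φ : F.obj S →ₗ[k] F.obj (X 0 ⊗ S) :=
    (μ F (X 0) S).hom ∘ₗ TensorProduct.mk k (F.obj (X 0)) (F.obj S) a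
  have h : φ ∘ₗ chi F (fun i : Fin n => X i.succ) =
      (List.ofFn fun i : Fin n => idem F X i.succ).prod ∘ₗ φ := by
    refine prod_comm _ _ _ fun i => LinearMap.ext fun c => ?_
    have h' := ModuleCat.hom_congr
      (μ_natural_right F (X 0) (tau (fun i : Fin n => X i.succ) i)) (a ⊗ₜ[k] c)
    change (μ F (X 0) S).hom (a ⊗ₜ[k] (c - (F.map (tau (fun i : Fin n => X i.succ) i)).hom c)) =
      (μ F (X 0) S).hom (a ⊗ₜ[k] c) -
        (F.map (X 0 ◁ tau (fun i : Fin n => X i.succ) i)).hom ((μ F (X 0) S).hom (a ⊗ₜ[k] c))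
    rw [TensorProduct.tmul_sub]
    refine (map_sub (μ F (X 0) S).hom _ _).trans ?_
    exact congrArg (fun e => (μ F (X 0) S).hom (a ⊗ₜ[k] c) - e) h'
  rw [chi_succ]
  refine (congrArg (idem F X 0) (LinearMap.congr_fun h b).symm).trans ?_
  change (μ F (X 0) S).hom (a ⊗ₜ[k] chi F (fun i : Fin n => X i.succ) b) -
    (F.map ((0 : X 0 ⟶ X 0) ▷ S)).hom
      ((μ F (X 0) S).hom (a ⊗ₜ[k] chi F (fun i : Fin n => X i.succ) b)) = _
  rw [map_whiskerRight_mu, ← map_sub, ← TensorProduct.sub_tmul]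

/-! ### `χ_F` when `id - F(0)` splits through a module `M`. -/

section Retract

variable {X : C} {M : ModuleCat.{u} k} {i : M ⟶ F.obj X} {p : F.obj X ⟶ M}

variable (hpi : p ≫ i = 𝟙 _ - F.map 0)

include hpi

/-- By `chi_mu`, `χ` is the `(n + 1)`-st tensor power of `id - F(0)`, which is `p` followed by `i`.
-/
theorem powIncl_powProj_apply (n : ℕ) (v : F.obj (prodObj fun _ : Fin (n + 1) => X)) :
    (powIncl F i n).hom ((powProj F p n).hom v) = chi F (fun _ : Fin (n + 1) => X) v := by
  have hpi' (a : F.obj X) : i.hom (p.hom a) = a - (F.map (0 : X ⟶ X)).hom a :=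
    ModuleCat.hom_congr hpi a
  induction n with
  | zero =>
    let w : F.obj (X ⊗ 𝟙_ C) := v
    have h : chi F (fun _ : Fin 1 => X) v = w - (F.map ((0 : X ⟶ X) ▷ 𝟙_ C)).hom w := by
      rw [chi_succ]
      rfl
    rw [h]
    change (F.map (ρ_ X).inv).hom (i.hom (p.hom ((F.map (ρ_ X).hom).hom w))) = _
    have h₀ : (ρ_ X).hom ≫ (0 : X ⟶ X) ≫ (ρ_ X).inv = (0 : X ⟶ X) ▷ 𝟙_ C := by
      rw [← rightUnitor_naturality_assoc, Iso.hom_inv_id, Category.comp_id]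
    rw [hpi', map_sub, map_map_apply, map_map_apply, map_map_apply, Iso.hom_inv_id, F.map_id, h₀]
    rfl
  | succ n ih =>
    let S : C := prodObj fun _ : Fin (n + 1) => X
    let L₁ : F.obj X ⊗[k] F.obj S →ₗ[k] F.obj (X ⊗ S) :=
      (powIncl F i (n + 1)).hom ∘ₗ (p ⊗ₘ powProj F p n).hom
    let L₂ : F.obj X ⊗[k] F.obj S →ₗ[k] F.obj (X ⊗ S) :=
      chi F (fun _ : Fin (n + 2) => X) ∘ₗ (μ F X S).hom
    have h : L₁ = L₂ := TensorProduct.ext' fun a b => by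
      refine Eq.trans ?_ (chi_mu F (fun _ : Fin (n + 2) => X) a b).symm
      rw [← hpi', ← ih]
      rfl
    have h' : (μ F X S).hom ((δ F X S).hom v) = v := ModuleCat.hom_congr (δ_μ F X S) v
    exact (LinearMap.congr_fun h ((δ F X S).hom v)).trans
      (congrArg (chi F fun _ : Fin (n + 2) => X) h')

/-- Since `p` annihilates `F(0)`, projecting to `M` before comultiplying changes nothing once both
outputs are projected to `M`. Hence the projections can be inserted at every stage of the iterated
diagonal. -/
theorem map_diag_powProj (hip : i ≫ p = 𝟙 M) (n : ℕ) :
    F.map (diag X (n + 1)) ≫ powProj F p n =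
      p ≫ iterComul (i ≫ F.map (lift (𝟙 X) (𝟙 X)) ≫ δ F X X ≫ (p ⊗ₘ p)) n := by
  have h₀ : F.map (0 : X ⟶ X) ≫ p = 0 := by
    have h : (p ≫ i) ≫ p = p := by rw [Category.assoc, hip, Category.comp_id]
    rw [hpi, Preadditive.sub_comp, Category.id_comp] at h
    exact sub_eq_self.mp h
  have h₁ : p ≫ i ≫ F.map (lift (𝟙 X) (𝟙 X)) ≫ δ F X X ≫ (p ⊗ₘ p) =
      F.map (lift (𝟙 X) (𝟙 X)) ≫ δ F X X ≫ (p ⊗ₘ p) := by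
    have h : (0 : X ⟶ X) ≫ lift (𝟙 X) (𝟙 X) = lift (𝟙 X) (𝟙 X) ≫ ((0 : X ⟶ X) ⊗ₘ (0 : X ⟶ X)) := by
      simp
    have h' : F.map (0 : X ⟶ X) ≫ F.map (lift (𝟙 X) (𝟙 X)) ≫ δ F X X ≫ (p ⊗ₘ p) = 0 := by
      rw [← F.map_comp_assoc, h, F.map_comp_assoc, ← δ_natural_assoc, tensorHom_comp_tensorHom, h₀]
      simp
    rw [← Category.assoc, hpi, Preadditive.sub_comp, Category.id_comp, h', sub_zero]
  induction n with
  | zero =>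
    change F.map (lift (𝟙 X) (toUnit X)) ≫ F.map (ρ_ X).hom ≫ p = p ≫ 𝟙 M
    rw [← F.map_comp_assoc, rightUnitor_hom, lift_fst, F.map_id, Category.id_comp, Category.comp_id]
  | succ n ih =>
    have h : lift (𝟙 X) (diag X (n + 1)) = lift (𝟙 X) (𝟙 X) ≫ X ◁ diag X (n + 1) := by simp
    change F.map (lift (𝟙 X) (diag X (n + 1))) ≫ δ F X (prodObj fun _ : Fin (n + 1) => X) ≫
        (p ⊗ₘ powProj F p n) = p ≫ (i ≫ F.map (lift (𝟙 X) (𝟙 X)) ≫ δ F X X ≫ (p ⊗ₘ p)) ≫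
          M ◁ iterComul (i ≫ F.map (lift (𝟙 X) (𝟙 X)) ≫ δ F X X ≫ (p ⊗ₘ p)) n
    rw [← Category.assoc p, h₁, h, F.map_comp_assoc, ← δ_natural_right_assoc, Category.assoc,
      Category.assoc, tensorHom_comp_whiskerLeft, ← ih]
    simp only [← id_tensorHom, tensorHom_comp_tensorHom, Category.id_comp]

/-- The polynomial filtration of `F(X)` in terms of the comultiplication of a complement of the
image of `F(0)`. -/
theorem polySub_eq_ker (hip : i ≫ p = 𝟙 M) (n : ℕ) :
    polySub F n X = LinearMap.ker
      (p ≫ iterComul (i ≫ F.map (lift (𝟙 X) (𝟙 X)) ≫ δ F X X ≫ (p ⊗ₘ p)) n).hom := by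
  rw [← map_diag_powProj F hpi hip]
  ext a
  have h := powIncl_powProj_apply F hpi n ((F.map (diag X (n + 1))).hom a)
  rw [polySub, LinearMap.mem_ker, LinearMap.mem_ker]
  refine ⟨fun ha => ?_, fun ha => ?_⟩
  -- `powIncl` has the retraction `powProj`, so `χ` and `powProj` vanish on the same elements.
  · have h' := congrArg (powProj F p n).hom (h.trans ha)
    rw [map_zero] at h'
    refine Eq.trans ?_ h'
    exact (ModuleCat.hom_congr (powIncl_powProj F hip n) _).symm
  · refine h.symm.trans ?_
    exact (congrArg (powIncl F i n).hom ha).trans (map_zero _)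

end Retract

end PolyFiltration

/-! ### Conilpotent Hopf algebras and analytic exponential functors -/

namespace Coradical

variable {k : Type u} [CommRing k] {H : Type u} [Ring H] [Bialgebra k H]

theorem augProj_coe (a : augIdeal k H) : augProj k H a = a := by
  have ha : Coalgebra.counit (R := k) (a : H) = 0 := a.2
  refine Subtype.ext ?_
  change (a : H) - algebraMap k H (Coalgebra.counit (R := k) (a : H)) = a
  rw [ha, map_zero, sub_zero]

theorem augProj_one : augProj k H 1 = 0 := by
  refine Subtype.ext ?_
  change (1 : H) - algebraMap k H (Coalgebra.counit (R := k) (1 : H)) = 0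
  rw [Bialgebra.counit_one, map_one, sub_self]

/-- Write `a = ε(a) 1 + (a - ε(a) 1)`. The unit contributes nothing to the augmentation ideal, so
the filtration is the preimage of a kernel under `augProj`. -/
theorem mem_coradFiltration (n : ℕ) (a : H) :
    a ∈ coradFiltration k H n ↔
      (iterComul (M := ModuleCat.of k (augIdeal k H)) (ModuleCat.ofHom (redComul k H)) n).hom
        (augProj k H a) = 0 := by
  refine ⟨fun h => ?_, fun h => ?_⟩
  · obtain ⟨b, hb, c, hc, rfl⟩ := Submodule.mem_sup.mp h
    obtain ⟨r, rfl⟩ := Submodule.mem_span_singleton.mp hb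
    obtain ⟨m, hm, rfl⟩ := hc
    rw [map_add, map_smul, augProj_one, smul_zero, zero_add]
    exact (congrArg _ (augProj_coe m)).trans hm
  · refine Submodule.mem_sup.mpr ⟨algebraMap k H (Coalgebra.counit a), ?_, (augProj k H a).1,
      ⟨augProj k H a, h, rfl⟩, ?_⟩
    · rw [Algebra.algebraMap_eq_smul_one]
      exact Submodule.smul_mem _ _ (Submodule.mem_span_singleton_self 1)
    · exact add_sub_cancel _ _

/-! ### Bialgebra homomorphisms respect the coradical filtration. -/

section Map

variable {H' : Type u} [Ring H'] [Bialgebra k H'] (φ : H →ₐc[k] H')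

/-- The map of augmentation ideals induced by a homomorphism of bialgebras. -/
def augMap : augIdeal k H →ₗ[k] augIdeal k H' :=
  LinearMap.restrict (φ : H →ₗ[k] H') fun a ha => by
    have h : Coalgebra.counit (R := k) (φ a) = Coalgebra.counit a :=
      CoalgHomClass.counit_comp_apply φ a
    exact h.trans ha

theorem augMap_augProj (a : H) : augMap φ (augProj k H a) = augProj k H' (φ a) := by
  refine Subtype.ext ?_
  have h : Coalgebra.counit (R := k) (φ a) = Coalgebra.counit a :=
      CoalgHomClass.counit_comp_apply φ a
  change φ (a - algebraMap k H (Coalgebra.counit a)) =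
    φ a - algebraMap k H' (Coalgebra.counit (φ a))
  rw [h, map_sub, AlgHomClass.commutes]

theorem redComul_augMap :
    redComul k H' ∘ₗ augMap φ = TensorProduct.map (augMap φ) (augMap φ) ∘ₗ redComul k H := by
  have h : augMap φ ∘ₗ augProj k H = augProj k H' ∘ₗ (φ : H →ₗ[k] H') :=
    LinearMap.ext (augMap_augProj φ)
  have h' : TensorProduct.map (φ : H →ₗ[k] H') (φ : H →ₗ[k] H') ∘ₗ Coalgebra.comul =
      Coalgebra.comul ∘ₗ (φ : H →ₗ[k] H') := CoalgHomClass.map_comp_comul φ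
  have key : TensorProduct.map (augProj k H') (augProj k H') ∘ₗ
      TensorProduct.map (φ : H →ₗ[k] H') (φ : H →ₗ[k] H') =
        TensorProduct.map (augMap φ) (augMap φ) ∘ₗ
          TensorProduct.map (augProj k H) (augProj k H) := by
    rw [← TensorProduct.map_comp, ← TensorProduct.map_comp, h]
  refine LinearMap.ext fun a => ?_
  refine (congrArg (TensorProduct.map (augProj k H') (augProj k H'))
    (LinearMap.congr_fun h' (a : H)).symm).trans ?_
  exact LinearMap.congr_fun key _

/-- The tensor power of a morphism. -/
def tensorPowMap {C : Type v} [Category.{w} C] [MonoidalCategory C] {M N : C} (f : M ⟶ N) :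
    (n : ℕ) → (tensorPow M n ⟶ tensorPow N n)
  | 0 => f
  | n + 1 => f ⊗ₘ tensorPowMap f n

theorem iterComul_tensorPowMap {C : Type v} [Category.{w} C] [MonoidalCategory C] {M N : C}
    (f : M ⟶ N) {d : M ⟶ M ⊗ M} {d' : N ⟶ N ⊗ N} (h : f ≫ d' = d ≫ (f ⊗ₘ f)) (n : ℕ) :
    f ≫ iterComul d' n = iterComul d n ≫ tensorPowMap f n := by
  induction n with
  | zero => exact (Category.comp_id f).trans (Category.id_comp f).symm
  | succ n ih =>
    change f ≫ d' ≫ N ◁ iterComul d' n = (d ≫ M ◁ iterComul d n) ≫ (f ⊗ₘ tensorPowMap f n)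
    rw [← Category.assoc, h, Category.assoc, Category.assoc]
    congr 1
    simp only [← id_tensorHom, tensorHom_comp_tensorHom, Category.id_comp, Category.comp_id, ih]

theorem map_mem_coradFiltration (n : ℕ) {a : H} (ha : a ∈ coradFiltration k H n) :
    φ a ∈ coradFiltration k H' n := by
  rw [mem_coradFiltration] at ha ⊢
  have h := iterComul_tensorPowMap (ModuleCat.ofHom (augMap φ))
    (d := ModuleCat.ofHom (redComul k H)) (d' := ModuleCat.ofHom (redComul k H'))
    (ModuleCat.hom_ext (redComul_augMap φ)) n
  rw [← augMap_augProj]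
  refine (ModuleCat.hom_congr h (augProj k H a)).trans ?_
  exact (congrArg (tensorPowMap (ModuleCat.ofHom (augMap φ)) n).hom ha).trans (map_zero _)

theorem IsConilpotent.of_surjective (h : IsConilpotent k H) (hφ : Function.Surjective φ) :
    IsConilpotent k H' := by
  intro b
  obtain ⟨a, rfl⟩ := hφ b
  exact (h a).imp fun n ha => map_mem_coradFiltration φ n ha

end Map

end Coradical

/-! ### Comparison of the two filtrations at `1`. -/

namespace ExpFunctor

open Coradical PolyFiltration

variable {k : Type u} [CommRing k] (F : ExpFunctor k)

/-- This is `polySub_eq_ker` with `M` the augmentation ideal of `F(1)`: there the induced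
comultiplication on `M` is the reduced one. -/
theorem polySub_one_eq (n : ℕ) :
    polySub F.toFunctor n GrOp.one = coradFiltration k F.ev₁Obj n := by
  let M : ModuleCat.{u} k := ModuleCat.of k (augIdeal k F.ev₁Obj)
  let i : M ⟶ F.toFunctor.obj GrOp.one := ModuleCat.ofHom (augIdeal k F.ev₁Obj).subtype
  let p : F.toFunctor.obj GrOp.one ⟶ M := ModuleCat.ofHom (augProj k F.ev₁Obj)
  have hip : i ≫ p = 𝟙 M := ModuleCat.hom_ext (LinearMap.ext augProj_coe)
  have hpi : p ≫ i = 𝟙 _ - F.toFunctor.map 0 := by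
    -- The zero endomorphism of `1` factors through `0`, so `F(0)` is unit after counit, and `id -
    -- F(0)` is the projection onto the augmentation ideal.
    have h₀ : (0 : GrOp.one ⟶ GrOp.one) = GrOp.counit ≫ GrOp.unit :=
      GrOp.hom_ext_one (GrOp.comp_unit_x GrOp.counit).symm
    have h : F.toFunctor.map (0 : GrOp.one ⟶ GrOp.one) =
        (F.toFunctor.map GrOp.counit ≫ Functor.OplaxMonoidal.η F.toFunctor) ≫
          Functor.LaxMonoidal.ε F.toFunctor ≫ F.toFunctor.map GrOp.unit := by
      rw [Category.assoc, Functor.Monoidal.η_ε_assoc, h₀, F.toFunctor.map_comp]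
    rw [h]
    rfl
  have hd : i ≫ F.toFunctor.map (lift (𝟙 GrOp.one) (𝟙 GrOp.one)) ≫
      Functor.OplaxMonoidal.δ F.toFunctor GrOp.one GrOp.one ≫ (p ⊗ₘ p) =
        ModuleCat.ofHom (redComul k F.ev₁Obj) := by
    rw [← GrOp.delta_eq]
    rfl
  rw [polySub_eq_ker F.toFunctor hpi hip, hd]
  ext a
  exact (mem_coradFiltration n (H := F.ev₁Obj) a).symm

theorem isConilpotent_of_isAnalytic (h : IsAnalytic F.toFunctor) : IsConilpotent k F.ev₁Obj := by
  intro a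
  obtain ⟨n, hn⟩ := (isAnalytic_iff F.toFunctor).mp h GrOp.one a
  exact ⟨n, (polySub_one_eq F n).le hn⟩

theorem isAnalytic_of_isConilpotent (h : IsConilpotent k F.ev₁Obj) : IsAnalytic F.toFunctor :=
  GrOp.isAnalytic_of_polySub_one F.toFunctor fun a =>
    (h a).imp fun n hn => (polySub_one_eq F n).ge hn

end ExpFunctor

/-! ### The two equivalences. -/

theorem theorem202207212109 (k : Type u) [CommRing k] :
    (ExpFunctor.ev₁ k).IsEquivalence ∧
      ∃ h : ∀ F : AnalyticExp k,
          IsConilpotentHopf k (((IsAnalyticExp k).ι ⋙ ExpFunctor.ev₁ k).obj F),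
        ((IsConilpotentHopf k).lift ((IsAnalyticExp k).ι ⋙ ExpFunctor.ev₁ k) h).IsEquivalence := by
  have h (F : AnalyticExp k) :
      IsConilpotentHopf k (((IsAnalyticExp k).ι ⋙ ExpFunctor.ev₁ k).obj F) :=
    ExpFunctor.isConilpotent_of_isAnalytic F.obj F.property
  refine ⟨inferInstance, h, ?_⟩
  have : ((IsConilpotentHopf k).lift ((IsAnalyticExp k).ι ⋙ ExpFunctor.ev₁ k) h).EssSurj := by
    refine ⟨fun H => ?_⟩
    let F := (ExpFunctor.ev₁ k).objPreimage H.obj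
    let e : (ExpFunctor.ev₁ k).obj F ≅ H.obj := (ExpFunctor.ev₁ k).objObjPreimageIso H.obj
    -- Conilpotency of `H` is carried to `F(1)` along the inverse isomorphism, which makes the
    -- preimage `F` analytic.
    let φ : H.obj.obj →ₐc[k] F.ev₁Obj := e.inv.hom.toBialgHom
    have hφ : Function.Surjective φ := fun a =>
      ⟨e.hom.hom.toBialgHom a, congrArg (fun f => f.hom.toBialgHom a) e.hom_inv_id⟩
    have hF : Coradical.IsConilpotent k F.ev₁Obj :=
      Coradical.IsConilpotent.of_surjective φ H.property hφ
    exact ⟨⟨F, ExpFunctor.isAnalytic_of_isConilpotent F hF⟩, ⟨(IsConilpotentHopf k).isoMk e⟩⟩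
  -- Fullness and faithfulness are inherited from `ev₁`, since both subcategories are full.
  exact { }
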